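/- Fix $\alpha,\beta\in\mathbb{R}$ with $\beta\neq 0$ and $(\alpha-1)^2+\beta^2\neq 1$, and put \[ \lambda=-2(2-2\alpha+\alpha^2+\beta^2)<-2,\qquad A=\begin{pmatrix}\alpha&\beta\\ \beta&2-\alpha\end{pmatrix},\qquad B=A+\tfrac{\lambda}{2}I . \] Let $G=\mathbb{R}^2\ltimes\mathbb{R}^2$ be the simply connected $4$-dimensional Lie group in which $(s,t)\in\mathbb{R}^2$ acts on $\mathbb{R}^2$ by $\exp(sB+tA)$, and let $H=\mathbb{R}\ltimes\mathbb{R}^2$ be the simply connected $3$-dimensional Lie group in which $t\in\mathbb{R}$ acts by $\exp(tA)$. For real $m>0$ put \[ z_m=\frac{2}{\sqrt{-(\lambda(m+2)+4)}},\qquad \rho_m=\frac{2\lambda(\lambda+2)}{\lambda(m+2)+4},\qquad F=z_mB, \] and let $g_m$ be the left invariant metric on $G$ with orthonormal left invariant frame $X_0=z_m\partial_s,\ X_1=\partial_t,\ X_2,X_3$ (at the identity), where $X_2,X_3$ is the standard basis of the normal subgroup $\mathbb{R}^2$. Let $r=s/z_m$, the signed distance from $\{s=0\}$, and $w_m=\exp\bigl(\sqrt{(\rho_m-\lambda)/m}\;r\bigr)$.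 Let $g_0$ be the left invariant metric on $H$ for which $\partial_t$ and the standard basis of $\mathbb{R}^2$ are orthonormal at the identity. Then: (1) $G$ is solvable, and for every $m>0$ the metric $g_m$ is left invariant, the frame $X_0,\dots,X_3$ is orthonormal and satisfies $[X_0,X_1]=[X_2,X_3]=0$, $[X_1,X_2]=\alpha X_2+\beta X_3$, $[X_1,X_3]=\beta X_2+(2-\alpha)X_3$, $[X_0,X_2]=F_{22}X_2+F_{23}X_3$, $[X_0,X_3]=F_{32}X_2+F_{33}X_3$ (the entries of $F$ being indexed by $2,3$), and $(G,g_m,w_m)$ is a $(\lambda,4+m)$-Einstein manifold: $g_m$ is a complete Riemannian metric, $w_m>0$ is smooth, $\mathrm{Hess}\,w_m=\frac{w_m}{m}(\mathrm{Ric}-\lambda g_m)$, and, if $m=1$, also $\Delta w_m=-\lambda w_m$. (2) $(H,g_0)$ is a $3$-dimensional solvsoliton with constant $\lambda$: $H$ is solvable, $g_0$ is a left invariant Riemannian metric, and $\mathrm{Ric}(g_0)=\lambda I+D$ for a derivation $D$ of the Lie algebra of $H$. Moreover $g_0$ is not Einstein. (3) As $m\to\infty$, the metrics $g_m$ converge in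 $C^\infty$ to the Riemannian product $(\mathbb{R}\times H,\ dx^2+g_0)$, and $\frac{m}{w_m}\nabla\nabla w_m$ converges in $C^\infty$ to the derivation $(-\lambda)\oplus D$ of $\mathbb{R}\oplus\mathfrak{h}$, whose restriction to $\mathfrak{h}$ is $D$. That is, there are diffeomorphisms $\varphi_m:\mathbb{R}\times H\to G$ taking identity to identity such that the components of $\varphi_m^*g_m$ and of the pulled-back endomorphism fields $\varphi_m^*\bigl(\frac{m}{w_m}\nabla\nabla w_m\bigr)$, in the global coordinates of $\mathbb{R}\times H\cong\mathbb{R}^4$, converge together with all their derivatives uniformly on compact sets to those of $dx^2+g_0$ and of $(-\lambda)\oplus D$, where $D$ is extended to a left invariant endomorphism field on $H$. -/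

import Mathlib

open scoped Manifold ContDiff Matrix Topology
open Filter

noncomputable section

/-! ### Riemannian geometry in global coordinates

All manifolds below are diffeomorphic to `ℝⁿ` and are described in one global chart. A tensor field
with two indices is the matrix field of its components with respect to the coordinate frame. -/

/-- The coordinate space `ℝⁿ`. -/
abbrev Coord (n : ℕ) : Type := Fin n → ℝ

/-- Fields of two-index tensors on `ℝⁿ`, by components in the coordinate frame. -/
abbrev TensorField (n : ℕ) : Type := Coord n → Matrix (Fin n) (Fin n) ℝ

/-- The partial derivative `∂ᵢ f`. -/
def partialDeriv {n : ℕ} (i : Fin n) (f : Coord n → ℝ) (x : Coord n) : ℝ :=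
  fderiv ℝ f x (Pi.single i 1)

/-- The Jacobian matrix of a map at a point. -/
def jacobian {n : ℕ} (f : Coord n → Coord n) (x : Coord n) : Matrix (Fin n) (Fin n) ℝ :=
  LinearMap.toMatrix' (fderiv ℝ f x : Coord n →ₗ[ℝ] Coord n)

/-- The pull-back `f^* T` of a field of bilinear forms. -/
def pullback {n : ℕ} (f : Coord n → Coord n) (T : TensorField n) : TensorField n :=
  fun x => (jacobian f x)ᵀ * T (f x) * jacobian f x

/-- The pull-back of a field of endomorphisms by a diffeomorphism. -/
def pullbackEndo {n : ℕ} (f : Coord n → Coord n) (T : TensorField n) : TensorField n :=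
  fun x => (jacobian f x)⁻¹ * T (f x) * jacobian f x

/-- A smooth Riemannian metric on `ℝⁿ`. -/
structure IsRiemannianMetric {n : ℕ} (g : TensorField n) : Prop where
  smooth : ∀ i j, ContDiff ℝ ∞ fun x => g x i j
  posDef : ∀ x, (g x).PosDef

/-- The Christoffel symbol `Γᵏᵢⱼ` of the Levi-Civita connection. -/
def christoffel {n : ℕ} (g : TensorField n) (k i j : Fin n) (x : Coord n) : ℝ :=
  (1 / 2) * ∑ l, (g x)⁻¹ k l *
    (partialDeriv i (fun y => g y j l) x + partialDeriv j (fun y => g y i l) x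
      - partialDeriv l (fun y => g y i j) x)

/-- The Ricci curvature, as a field of bilinear forms:
`Ricᵢⱼ = ∂ₖΓᵏᵢⱼ - ∂ⱼΓᵏᵢₖ + ΓᵏₖₗΓˡᵢⱼ - ΓᵏⱼₗΓˡᵢₖ`. -/
def ricci {n : ℕ} (g : TensorField n) : TensorField n := fun x => Matrix.of fun i j =>
  ∑ k, (partialDeriv k (christoffel g k i j) x - partialDeriv j (christoffel g k i k) x) +
  ∑ k, ∑ l, (christoffel g k k l x * christoffel g l i j x
    - christoffel g k j l x * christoffel g l i k x)

/-- The Ricci curvature as a field of endomorphisms. -/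
def ricciEndo {n : ℕ} (g : TensorField n) : TensorField n := fun x => (g x)⁻¹ * ricci g x

/-- The Hessian of a function, as a field of bilinear forms:
`(Hess f)ᵢⱼ = ∂ᵢ∂ⱼ f - Γᵏᵢⱼ ∂ₖ f`. -/
def hessian {n : ℕ} (g : TensorField n) (f : Coord n → ℝ) : TensorField n :=
  fun x => Matrix.of fun i j =>
    partialDeriv i (partialDeriv j f) x - ∑ k, christoffel g k i j x * partialDeriv k f x

/-- The Hessian as a field of endomorphisms, `X ↦ ∇_X ∇f`. -/
def hessianEndo {n : ℕ} (g : TensorField n) (f : Coord n → ℝ) : TensorField n :=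
  fun x => (g x)⁻¹ * hessian g f x

/-- The Laplacian `Δ f = tr (∇∇f)`. -/
def laplacian {n : ℕ} (g : TensorField n) (f : Coord n → ℝ) (x : Coord n) : ℝ :=
  (hessianEndo g f x).trace

/-- The length of a curve over the parameter interval `[0, 1]`. -/
def curveLength {n : ℕ} (g : TensorField n) (γ : ℝ → Coord n) : ℝ :=
  ∫ t in (0 : ℝ)..1, Real.sqrt (deriv γ t ⬝ᵥ (g (γ t) *ᵥ deriv γ t))

/-- The Riemannian distance: the infimum of the lengths of `C¹` curves. -/
def riemannianDist {n : ℕ} (g : TensorField n) (x y : Coord n) : ℝ :=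
  sInf {L | ∃ γ : ℝ → Coord n, ContDiff ℝ 1 γ ∧ γ 0 = x ∧ γ 1 = y ∧ L = curveLength g γ}

/-- Completeness of a Riemannian metric: Cauchy sequences for its distance converge. -/
def IsCompleteMetric {n : ℕ} (g : TensorField n) : Prop :=
  ∀ u : ℕ → Coord n,
    (∀ ε > 0, ∃ N, ∀ i ≥ N, ∀ j ≥ N, riemannianDist g (u i) (u j) < ε) →
    ∃ a, Tendsto (fun i => riemannianDist g (u i) a) atTop (𝓝 0)

/-- `(ℝⁿ, g, w)` is a `(lam, n + m)`-Einstein manifold (without boundary). -/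
structure IsWarpedEinstein {n : ℕ} (lam m : ℝ) (g : TensorField n) (w : Coord n → ℝ) : Prop where
  isRiemannian : IsRiemannianMetric g
  isComplete : IsCompleteMetric g
  smooth : ContDiff ℝ ∞ w
  pos : ∀ x, 0 < w x
  hess_eq : ∀ x, hessian g w x = (w x / m) • (ricci g x - lam • g x)
  laplacian_eq : m = 1 → ∀ x, laplacian g w x = -lam * w x

/-- `g` is an Einstein metric. -/
def IsEinstein {n : ℕ} (g : TensorField n) : Prop := ∃ c : ℝ, ∀ x, ricci g x = c • g x

/-- The Riemannian product metric `dt² + g` on `ℝ × ℝⁿ = ℝⁿ⁺¹`, `t` being coordinate `0`. -/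
def lineProd {n : ℕ} (g : TensorField n) : TensorField (n + 1) := fun x => Matrix.of fun i j =>
  Fin.cases (Fin.cases 1 (fun _ => 0) j)
    (fun i' => Fin.cases 0 (fun j' => g (Fin.tail x) i' j') j) i

/-- The field of endomorphisms `c ⊕ T` on `ℝ × ℝⁿ = ℝⁿ⁺¹`: multiplication by `c` on the
line and `T` on the second factor. -/
def lineSum {n : ℕ} (c : ℝ) (T : TensorField n) : TensorField (n + 1) :=
  fun x => Matrix.of fun i j =>
    Fin.cases (Fin.cases c (fun _ => 0) j)
      (fun i' => Fin.cases 0 (fun j' => T (Fin.tail x) i' j') j) i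

/-- `C^∞` convergence of tensor fields `T m → T'` as `m → ∞`: all derivatives of all
components converge uniformly on compact sets. -/
def SmoothTendsto {n : ℕ} (T : ℝ → TensorField n) (T' : TensorField n) : Prop :=
  ∀ (i j : Fin n) (k : ℕ) (K : Set (Coord n)), IsCompact K →
    TendstoUniformlyOn (fun m x => iteratedFDeriv ℝ k (fun y => T m y i j) x)
      (fun x => iteratedFDeriv ℝ k (fun y => T' y i j) x) atTop K

/-! ### Simply connected Lie groups with underlying manifold `ℝⁿ` -/

/-- A Lie group structure on the manifold `ℝⁿ`. -/
structure LieLaw (n : ℕ) where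
  mul : Coord n → Coord n → Coord n
  one : Coord n
  inv : Coord n → Coord n
  mul_assoc : ∀ x y z, mul (mul x y) z = mul x (mul y z)
  one_mul : ∀ x, mul one x = x
  mul_one : ∀ x, mul x one = x
  inv_mul : ∀ x, mul (inv x) x = one
  smooth_mul : ContDiff ℝ ∞ fun p : Coord n × Coord n => mul p.1 p.2
  smooth_inv : ContDiff ℝ ∞ inv

namespace LieLaw

variable {n : ℕ}

/-- The Lie group given by the group law `L`; as a manifold it is `ℝⁿ`. -/
def Carrier (_L : LieLaw n) : Type := Coord n

instance (L : LieLaw n) : TopologicalSpace L.Carrier := inferInstanceAs (TopologicalSpace (Coord n))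

instance (L : LieLaw n) : ChartedSpace (Coord n) L.Carrier :=
  inferInstanceAs (ChartedSpace (Coord n) (Coord n))

instance (L : LieLaw n) : Group L.Carrier where
  mul := L.mul
  one := L.one
  inv := L.inv
  mul_assoc := L.mul_assoc
  one_mul := L.one_mul
  mul_one := L.mul_one
  inv_mul_cancel := L.inv_mul

theorem lieGroup_aux (L : LieLaw n) : LieGroup 𝓘(ℝ, Coord n) ∞ L.Carrier where
  toIsManifold := inferInstanceAs (IsManifold 𝓘(ℝ, Coord n) ∞ (Coord n))
  contMDiff_mul := by
    have h := L.smooth_mul.contMDiff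
    rw [modelWithCornersSelf_prod, ← chartedSpaceSelf_prod] at h
    exact h
  contMDiff_inv := L.smooth_inv.contMDiff

instance (L : LieLaw n) : LieGroup 𝓘(ℝ, Coord n) ∞ L.Carrier := L.lieGroup_aux

instance (L : LieLaw n) : LieGroup 𝓘(ℝ, Coord n) (minSmoothness ℝ 3) L.Carrier :=
  LieGroup.of_le (n := ∞) (by
    rw [minSmoothness_of_isRCLikeNormedField]; exact ENat.LEInfty.out)

/-- The Lie algebra of the Lie group. -/
abbrev LieAlg (L : LieLaw n) : Type := GroupLieAlgebra 𝓘(ℝ, Coord n) L.Carrier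

/-- A field of bilinear forms is left invariant: all left translations preserve it. -/
def IsLeftInvariant (L : LieLaw n) (g : TensorField n) : Prop :=
  ∀ a, pullback (L.mul a) g = g

/-- The inner product which a field of bilinear forms gives on the tangent space at the identity. -/
def innerAtOne (L : LieLaw n) (g : TensorField n) (X Y : L.LieAlg) : ℝ :=
  let u : Coord n := X
  let v : Coord n := Y
  u ⬝ᵥ (g L.one *ᵥ v)

/-- The left invariant field of endomorphisms with value `D` at the identity. -/
def extend (L : LieLaw n) (D : L.LieAlg →ₗ[ℝ] L.LieAlg) : TensorField n := fun x =>
  let D' : Coord n →ₗ[ℝ] Coord n := D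
  jacobian (L.mul x) L.one * LinearMap.toMatrix' D' * (jacobian (L.mul x) L.one)⁻¹

/-- The left invariant metric `g` satisfies the solvsoliton equation `Ric(g) = c I + D` for the
derivation `D` of the Lie algebra of a simply connected solvable Lie group. -/
structure IsSolvsoliton (L : LieLaw n) (g : TensorField n) (c : ℝ)
    (D : LieDerivation ℝ L.LieAlg L.LieAlg) : Prop where
  isSolvable : Group.IsSolvable L.Carrier
  isRiemannian : IsRiemannianMetric g
  isLeftInvariant : L.IsLeftInvariant g
  ricci_eq : ∀ x, ricciEndo g x = c • (1 : Matrix (Fin n) (Fin n) ℝ) + L.extend D x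

end LieLaw

/-! ### The groups `G`, `H` and their metrics -/

/-- The constant `λ = -2(2 - 2α + α² + β²)`. -/
def lamConst (α β : ℝ) : ℝ := -2 * (2 - 2 * α + α ^ 2 + β ^ 2)

/-- The matrix of `ad X₁` on `span {X₂, X₃}`. -/
def matA (α β : ℝ) : Matrix (Fin 2) (Fin 2) ℝ := !![α, β; β, 2 - α]

/-- The matrix `A + (λ/2) I`; the matrix of `ad X₀` on `span {X₂, X₃}` is a multiple of it. -/
def matB (α β : ℝ) : Matrix (Fin 2) (Fin 2) ℝ := matA α β + (lamConst α β / 2) • 1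

/-- `exp (s B + t A)`. -/
def expBA (α β s t : ℝ) : Matrix (Fin 2) (Fin 2) ℝ :=
  NormedSpace.exp (s • matB α β + t • matA α β)

theorem commute_BA (α β s t s' t' : ℝ) :
    Commute (s • matB α β + t • matA α β) (s' • matB α β + t' • matA α β) := by
  have h : Commute (matB α β) (matA α β) := by
    unfold matB
    exact (Commute.refl _).add_left ((Commute.one_left _).smul_left _)
  exact (((Commute.refl _).smul_left _).smul_right _ |>.add_right
    ((h.smul_left _).smul_right _)).add_left
    (((h.symm.smul_left _).smul_right _).add_right (((Commute.refl _).smul_left _).smul_right _))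

theorem expBA_add (α β s t s' t' : ℝ) :
    expBA α β (s + s') (t + t') = expBA α β s t * expBA α β s' t' := by
  unfold expBA
  rw [← Matrix.exp_add_of_commute _ _ (commute_BA α β s t s' t')]
  congr 1
  simp only [add_smul]
  abel

theorem expBA_zero (α β : ℝ) : expBA α β 0 0 = 1 := by simp [expBA]

theorem contDiff_expBA (α β : ℝ) (i j : Fin 2) :
    ContDiff ℝ ∞ fun p : ℝ × ℝ => expBA α β p.1 p.2 i j := by
  let _ : NormedRing (Matrix (Fin 2) (Fin 2) ℝ) := Matrix.linftyOpNormedRing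
  let _ : NormedAlgebra ℝ (Matrix (Fin 2) (Fin 2) ℝ) := Matrix.linftyOpNormedAlgebra
  have h1 : ContDiff ℝ ∞ (NormedSpace.exp : Matrix (Fin 2) (Fin 2) ℝ → _) :=
    contDiff_iff_contDiffAt.2 fun x => (NormedSpace.exp_analytic (𝕂 := ℝ) x).contDiffAt
  have h2 : ContDiff ℝ ∞ fun p : ℝ × ℝ => p.1 • matB α β + p.2 • matA α β :=
    (contDiff_fst.smul contDiff_const).add (contDiff_snd.smul contDiff_const)
  have h3 : ContDiff ℝ ∞ fun M : Matrix (Fin 2) (Fin 2) ℝ => M i j :=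
    (LinearMap.toContinuousLinearMap (Matrix.entryLinearMap ℝ ℝ i j)).contDiff
  exact h3.comp (h1.comp h2)

/-- The four dimensional group `G = ℝ² ⋉ ℝ²`, in which `(s, t) ∈ ℝ²` acts on `ℝ²` by
`exp (s B + t A)`. -/
def lawG (α β : ℝ) : LieLaw 4 where
  mul x y := ![x 0 + y 0, x 1 + y 1,
    x 2 + (expBA α β (x 0) (x 1) *ᵥ ![y 2, y 3]) 0,
    x 3 + (expBA α β (x 0) (x 1) *ᵥ ![y 2, y 3]) 1]
  one := 0
  inv x := ![-x 0, -x 1,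
    -(expBA α β (-x 0) (-x 1) *ᵥ ![x 2, x 3]) 0,
    -(expBA α β (-x 0) (-x 1) *ᵥ ![x 2, x 3]) 1]
  mul_assoc x y z := by
    ext i
    fin_cases i <;>
      simp [expBA_add, Matrix.mulVec, dotProduct, Fin.sum_univ_two, Matrix.mul_apply] <;> ring
  one_mul x := by
    ext i
    fin_cases i <;> simp [expBA_zero]
  mul_one x := by
    ext i
    fin_cases i <;> simp [Matrix.mulVec, dotProduct, Fin.sum_univ_two]
  inv_mul x := by
    ext i
    fin_cases i <;> simp
  smooth_mul := by
    rw [contDiff_pi]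
    have e : ∀ i j, ContDiff ℝ ∞ fun p : Coord 4 × Coord 4 =>
        expBA α β (p.1 0) (p.1 1) i j := fun i j =>
      (contDiff_expBA α β i j).comp (f := fun p : Coord 4 × Coord 4 => (p.1 0, p.1 1))
        (by fun_prop)
    intro i
    fin_cases i <;> simp [Matrix.mulVec, dotProduct, Fin.sum_univ_two] <;> fun_prop
  smooth_inv := by
    rw [contDiff_pi]
    have e : ∀ i j, ContDiff ℝ ∞ fun p : Coord 4 => expBA α β (-p 0) (-p 1) i j := fun i j =>
      (contDiff_expBA α β i j).comp (f := fun p : Coord 4 => (-p 0, -p 1)) (by fun_prop)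
    intro i
    fin_cases i <;> simp [Matrix.mulVec, dotProduct, Fin.sum_univ_two] <;> fun_prop

/-- The three dimensional group `H = ℝ ⋉ ℝ²`, in which `t ∈ ℝ` acts on `ℝ²` by `exp (t A)`. -/
def lawH (α β : ℝ) : LieLaw 3 where
  mul x y := ![x 0 + y 0,
    x 1 + (expBA α β 0 (x 0) *ᵥ ![y 1, y 2]) 0,
    x 2 + (expBA α β 0 (x 0) *ᵥ ![y 1, y 2]) 1]
  one := 0
  inv x := ![-x 0,
    -(expBA α β 0 (-x 0) *ᵥ ![x 1, x 2]) 0,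
    -(expBA α β 0 (-x 0) *ᵥ ![x 1, x 2]) 1]
  mul_assoc x y z := by
    have h := expBA_add α β 0 (x 0) 0 (y 0)
    rw [add_zero] at h
    ext i
    fin_cases i <;>
      simp [h, Matrix.mulVec, dotProduct, Fin.sum_univ_two, Matrix.mul_apply] <;> ring
  one_mul x := by
    ext i
    fin_cases i <;> simp [expBA_zero]
  mul_one x := by
    ext i
    fin_cases i <;> simp [Matrix.mulVec, dotProduct, Fin.sum_univ_two]
  inv_mul x := by
    ext i
    fin_cases i <;> simp
  smooth_mul := by
    rw [contDiff_pi]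
    have e : ∀ i j, ContDiff ℝ ∞ fun p : Coord 3 × Coord 3 =>
        expBA α β 0 (p.1 0) i j := fun i j =>
      (contDiff_expBA α β i j).comp (f := fun p : Coord 3 × Coord 3 => ((0 : ℝ), p.1 0))
        (by fun_prop)
    intro i
    fin_cases i <;> simp [Matrix.mulVec, dotProduct, Fin.sum_univ_two] <;> fun_prop
  smooth_inv := by
    rw [contDiff_pi]
    have e : ∀ i j, ContDiff ℝ ∞ fun p : Coord 3 => expBA α β 0 (-p 0) i j := fun i j =>
      (contDiff_expBA α β i j).comp (f := fun p : Coord 3 => ((0 : ℝ), -p 0)) (by fun_prop)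
    intro i
    fin_cases i <;> simp [Matrix.mulVec, dotProduct, Fin.sum_univ_two] <;> fun_prop

/-- The structure constant `z > 0`, with `z² = -4 / (λ (m + 2) + 4)`. -/
def zConst (α β m : ℝ) : ℝ := 2 / Real.sqrt (-(lamConst α β * (m + 2) + 4))

/-- The constant `ρ = 2 λ (λ + 2) / (λ (m + 2) + 4)`. -/
def rhoConst (α β m : ℝ) : ℝ :=
  2 * lamConst α β * (lamConst α β + 2) / (lamConst α β * (m + 2) + 4)

/-- The matrix `F = z (A + (λ/2) I)` of `ad X₀` on `span {X₂, X₃}`. -/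
def matF (α β m : ℝ) : Matrix (Fin 2) (Fin 2) ℝ := zConst α β m • matB α β

/-- The left invariant frame on `G`, by its values at the identity:
`X₀ = z ∂₀`, `X₁ = ∂₁`, `X₂ = ∂₂`, `X₃ = ∂₃`. -/
def frameG (α β m : ℝ) : Fin 4 → (lawG α β).LieAlg :=
  ![(Pi.single 0 (zConst α β m) : Coord 4), (Pi.single 1 1 : Coord 4),
    (Pi.single 2 1 : Coord 4), (Pi.single 3 1 : Coord 4)]

/-- The metric `g_m = z⁻² ds² + dt² + |exp (-(s B + t A)) dy|²` on `G`, in coordinates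
`(s, t, y)`: the left invariant metric with orthonormal frame `frameG α β m`. -/
def metricG (α β m : ℝ) : TensorField 4 := fun x =>
  let P := (expBA α β (-x 0) (-x 1))ᵀ * expBA α β (-x 0) (-x 1)
  !![(zConst α β m ^ 2)⁻¹, 0, 0, 0;
     0, 1, 0, 0;
     0, 0, P 0 0, P 0 1;
     0, 0, P 1 0, P 1 1]

/-- The potential function `w_m = exp (√((ρ - λ) / m) r)`, where `r = s / z` is the signed distance
from the normal subgroup `{s = 0}`, so that `∇ r = X₀`. -/
def potentialG (α β m : ℝ) : Coord 4 → ℝ := fun x =>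
  Real.exp (Real.sqrt ((rhoConst α β m - lamConst α β) / m) * (x 0 / zConst α β m))

/-- The metric `g₀ = dt² + |exp (-t A) dy|²` on `H`, in coordinates `(t, y)`. -/
def metricH (α β : ℝ) : TensorField 3 := fun x =>
  let P := (expBA α β 0 (-x 0))ᵀ * expBA α β 0 (-x 0)
  !![1, 0, 0;
     0, P 0 0, P 0 1;
     0, P 1 0, P 1 1]

end

noncomputable section

/-! ### The matrices `exp (s B + t A)` -/

/-! The constants encode trace identities: `tr A = 2`, `tr A² = -λ`, hence `tr AB = 0`, `tr B = λ +
2` and `tr B² = λ(λ + 2)/2`. For symmetric commuting actions `F` of `X₀` and `A` of `X₁` on an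
abelian ideal, `Ric` has entries `-tr F²`, `-tr FA`, `-tr A²` on the base and equals `-(tr F)F - (tr
A)A` on the fibre. So `Ric - λ` is `ρ - λ` on `X₀`, zero on `X₁`, and `-(z²(λ + 2) + 2)B` on the
fibre. The potential is `w = exp(-λs/2)`, and `(m/w)∇∇w` is `mλ²z²/4`, zero and `(λmz²/2)B` on the
same blocks. The two agree exactly when `z²(λ(m + 2) + 4) = -4`.

These formulas are verified in coordinates. Every `exp(sB + tA)` is a combination `U + VA`, and by
Cayley-Hamilton the span of `U`, `V` is stable under partial derivatives (`IsDerivPair`). Metric and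
Christoffel symbols are then affine in `U`, `V` with constant coefficients, and `ricci_metricG`,
`hessian_potentialG`, `ricci_metricH` reduce to polynomial identities.

On `H` the same computation gives `Ric = λ` on `∂ₜ` and `-2A = λ + (-2A - λ)` on the fibre, and `0 ⊕
(-2A - λ)` is a derivation. Completeness follows because the metric controls `s` and `t`, and over
bounded `(s, t)` also the fibre. For the limit, `(x, h) ↦ (zx, h)` puts all dependence of the metric
on `m` into a linear map that tends to a projection as `z → 0`; the rescaled Hessian is a constant
matrix whose entries converge. -/

theorem matA_transpose (α β : ℝ) : (matA α β)ᵀ = matA α β := by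
  ext i j
  fin_cases i <;> fin_cases j <;> simp [matA]

theorem matB_transpose (α β : ℝ) : (matB α β)ᵀ = matB α β := by
  simp [matB, matA_transpose]

theorem expBA_transpose (α β s t : ℝ) : (expBA α β s t)ᵀ = expBA α β s t := by
  unfold expBA
  rw [← Matrix.exp_transpose]
  simp [matA_transpose, matB_transpose]

theorem expBA_mul_neg (α β s t : ℝ) : expBA α β s t * expBA α β (-s) (-t) = 1 := by
  rw [← expBA_add]
  simp [expBA_zero]

/-- By symmetry the fibre part of the metric is again a matrix of the family, so one differentiation
formula serves for all its components. -/
theorem expBA_gram (α β s t : ℝ) :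
    (expBA α β (-s) (-t))ᵀ * expBA α β (-s) (-t) = expBA α β (-2 * s) (-2 * t) := by
  rw [expBA_transpose, ← expBA_add]
  congr 1 <;> ring

theorem commute_expBA_matA (α β s t : ℝ) : Commute (expBA α β s t) (matA α β) := by
  let _ : NormedRing (Matrix (Fin 2) (Fin 2) ℝ) := Matrix.linftyOpNormedRing
  let _ : NormedAlgebra ℝ (Matrix (Fin 2) (Fin 2) ℝ) := Matrix.linftyOpNormedAlgebra
  have h := commute_BA α β s t 0 1
  rw [zero_smul, zero_add, one_smul] at h
  exact h.exp_left

/-- The derivative of `exp (s B + t A)` along a line. -/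
theorem hasDerivAt_expBA_line (α β s t a b : ℝ) (i j : Fin 2) :
    HasDerivAt (fun h : ℝ => expBA α β (s + h * a) (t + h * b) i j)
      (((a • matB α β + b • matA α β) * expBA α β s t) i j) 0 := by
  let _ : NormedRing (Matrix (Fin 2) (Fin 2) ℝ) := Matrix.linftyOpNormedRing
  let _ : NormedAlgebra ℝ (Matrix (Fin 2) (Fin 2) ℝ) := Matrix.linftyOpNormedAlgebra
  have e : (fun h : ℝ => expBA α β (s + h * a) (t + h * b)) = fun h : ℝ =>
      NormedSpace.exp (h • (a • matB α β + b • matA α β)) * expBA α β s t := by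
    funext h
    rw [add_comm s, add_comm t, expBA_add]
    congr 1
    simp only [expBA, smul_add, mul_smul]
  have h1 := (hasDerivAt_exp_smul_const (𝕂 := ℝ) (a • matB α β + b • matA α β) 0).mul_const
    (expBA α β s t)
  rw [zero_smul, NormedSpace.exp_zero, one_mul] at h1
  have h2 := (LinearMap.toContinuousLinearMap (Matrix.entryLinearMap ℝ ℝ i j)).hasFDerivAt
    |>.comp_hasDerivAt (0 : ℝ) h1
  exact h2.congr_of_eventuallyEq
    (Eventually.of_forall fun h => congrFun (congrFun (congrFun e h) i) j)

/-- The coefficient of `A` when `exp (s B + t A)` is written in the basis `1, A`. -/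
def expCoeffA (α β s t : ℝ) : ℝ := expBA α β s t 0 1 / β

/-- The coefficient of `1` when `exp (s B + t A)` is written in the basis `1, A`. -/
def expCoeffOne (α β s t : ℝ) : ℝ := expBA α β s t 0 0 - expBA α β s t 0 1 / β * α

/-- Since `β ≠ 0`, `A` is not scalar, so a 2×2 matrix commuting with it lies in the span of `1` and
`A`. -/
theorem expBA_eq (α β : ℝ) (hβ : β ≠ 0) (s t : ℝ) :
    expBA α β s t =
      !![expCoeffOne α β s t + expCoeffA α β s t * α, expCoeffA α β s t * β;
        expCoeffA α β s t * β, expCoeffOne α β s t + expCoeffA α β s t * (2 - α)] := by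
  have h1 : expBA α β s t 1 0 = expBA α β s t 0 1 :=
    congrFun (congrFun (expBA_transpose α β s t) 0) 1
  -- This entry of the commutation relation expresses the difference of the diagonal entries through
  -- the off-diagonal one.
  have h2 := congrFun (congrFun (commute_expBA_matA α β s t).eq 0) 1
  simp [matA, Matrix.mul_apply, Fin.sum_univ_two] at h2
  ext i j
  fin_cases i <;> fin_cases j <;> simp [expCoeffOne, expCoeffA, h1]
  · field_simp
  · field_simp
  · field_simp
    linarith

theorem contDiff_expCoeffA (α β : ℝ) :
    ContDiff ℝ ∞ fun p : ℝ × ℝ => expCoeffA α β p.1 p.2 :=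
  (contDiff_expBA α β 0 1).div_const β

theorem contDiff_expCoeffOne (α β : ℝ) :
    ContDiff ℝ ∞ fun p : ℝ × ℝ => expCoeffOne α β p.1 p.2 :=
  (contDiff_expBA α β 0 0).sub ((contDiff_expCoeffA α β).mul contDiff_const)

/-- The determinant of `A`. -/
def detA (α β : ℝ) : ℝ := α * (2 - α) - β ^ 2

/-- The derivative is `(aλ/2 + (a + b)A)(c₁ + c_A A)`; Cayley-Hamilton, `A² = 2A - det A`, brings it
back to the basis `1, A`. -/
theorem hasDerivAt_expCoeffA_line (α β : ℝ) (hβ : β ≠ 0) (s t a b : ℝ) :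
    HasDerivAt (fun h : ℝ => expCoeffA α β (s + h * a) (t + h * b))
      (a * (lamConst α β / 2) * expCoeffA α β s t
        + (a + b) * (expCoeffOne α β s t + 2 * expCoeffA α β s t)) 0 := by
  have h := (hasDerivAt_expBA_line α β s t a b 0 1).div_const β
  refine h.congr_deriv ?_
  rw [expBA_eq α β hβ]
  simp [matB, matA, Matrix.mul_apply, Fin.sum_univ_two]
  field_simp
  ring

theorem hasDerivAt_expCoeffOne_line (α β : ℝ) (hβ : β ≠ 0) (s t a b : ℝ) :
    HasDerivAt (fun h : ℝ => expCoeffOne α β (s + h * a) (t + h * b))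
      (a * (lamConst α β / 2) * expCoeffOne α β s t
        - (a + b) * (detA α β * expCoeffA α β s t)) 0 := by
  have h := (hasDerivAt_expBA_line α β s t a b 0 0).sub
    ((hasDerivAt_expCoeffA_line α β hβ s t a b).mul_const α)
  refine h.congr_deriv ?_
  rw [expBA_eq α β hβ]
  simp [matB, matA, Matrix.mul_apply, Fin.sum_univ_two, detA]
  ring

/-! ### Partial derivatives -/

section PartialDeriv

variable {n : ℕ}

theorem partialDeriv_eq_of_hasDerivAt {f : Coord n → ℝ} {x : Coord n} {i : Fin n} {d : ℝ}
    (hf : DifferentiableAt ℝ f x)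
    (h : HasDerivAt (fun s : ℝ => f (x + s • Pi.single i 1)) d 0) : partialDeriv i f x = d := by
  unfold partialDeriv
  rw [← hf.lineDeriv_eq_fderiv]
  exact h.deriv

theorem partialDeriv_affine {U V : Coord n → ℝ} (hU : Differentiable ℝ U) (hV : Differentiable ℝ V)
    (i : Fin n) (c₀ c₁ c₂ : ℝ) (x : Coord n) :
    partialDeriv i (fun y => c₀ + c₁ * U y + c₂ * V y) x =
      c₁ * partialDeriv i U x + c₂ * partialDeriv i V x := by
  have h := (((hU x).hasFDerivAt.const_mul c₁).const_add c₀).add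
    ((hV x).hasFDerivAt.const_mul c₂)
  have h' : HasFDerivAt (fun y => c₀ + c₁ * U y + c₂ * V y) _ x := h
  unfold partialDeriv
  rw [h'.fderiv]
  simp

/-- The Christoffel symbols are determined by the equations for the lowered symbols. -/
theorem christoffel_eq_of_lowered {g : TensorField n} (hg : IsRiemannianMetric g)
    (Γ : Fin n → Fin n → Fin n → Coord n → ℝ)
    (h : ∀ i j l x, ∑ k, g x l k * Γ k i j x = (1 / 2) *
      (partialDeriv i (fun y => g y j l) x + partialDeriv j (fun y => g y i l) x
        - partialDeriv l (fun y => g y i j) x)) : christoffel g = Γ := by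
  funext k i j x
  have hdet : IsUnit (g x).det := (Matrix.isUnit_iff_isUnit_det _).1 (hg.posDef x).isUnit
  have e : g x *ᵥ (fun k => Γ k i j x) = (1 / 2 : ℝ) • fun l =>
      (partialDeriv i (fun y => g y j l) x + partialDeriv j (fun y => g y i l) x
        - partialDeriv l (fun y => g y i j) x) := by
    funext l
    exact h i j l x
  have e2 := congrArg (fun v => ((g x)⁻¹ *ᵥ v) k) e
  simp only [Matrix.mulVec_mulVec, Matrix.nonsing_inv_mul _ hdet, Matrix.one_mulVec,
    Matrix.mulVec_smul] at e2
  rw [e2]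
  rfl

end PartialDeriv

/-! ### Metrics with components in the span of three functions -/

/-- Two functions `U`, `V` on `ℝⁿ` whose span is closed under partial derivatives:
`∂ₖ U = e k U + f k V` and `∂ₖ V = e' k U + f' k V`. -/
structure IsDerivPair {n : ℕ} (U V : Coord n → ℝ) (e f e' f' : Fin n → ℝ) : Prop where
  diff_left : Differentiable ℝ U
  diff_right : Differentiable ℝ V
  deriv_left : ∀ k x, partialDeriv k U x = e k * U x + f k * V x
  deriv_right : ∀ k x, partialDeriv k V x = e' k * U x + f' k * V x

namespace IsDerivPair

variable {n : ℕ} {U V : Coord n → ℝ} {e f e' f' : Fin n → ℝ}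

theorem partialDeriv_affine (h : IsDerivPair U V e f e' f') (k : Fin n) (c₀ c₁ c₂ : ℝ)
    (x : Coord n) : partialDeriv k (fun y => c₀ + c₁ * U y + c₂ * V y) x =
      c₁ * (e k * U x + f k * V x) + c₂ * (e' k * U x + f' k * V x) := by
  rw [_root_.partialDeriv_affine h.diff_left h.diff_right, h.deriv_left, h.deriv_right]

/-- In `hc` the values of `U` and `V` are replaced by independent real variables, so what remains to
check for a given metric is a finite list of polynomial identities. -/
theorem christoffel_eq (h : IsDerivPair U V e f e' f') {g : TensorField n}
    (hg : IsRiemannianMetric g) {g₀ g₁ g₂ : Matrix (Fin n) (Fin n) ℝ}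
    (hgU : ∀ x i j, g x i j = g₀ i j + g₁ i j * U x + g₂ i j * V x)
    (c₀ c₁ c₂ : Fin n → Matrix (Fin n) (Fin n) ℝ)
    (hc : ∀ i j l u v, ∑ k, (g₀ l k + g₁ l k * u + g₂ l k * v) *
        (c₀ k i j + c₁ k i j * u + c₂ k i j * v) = (1 / 2) *
      ((g₁ j l * (e i * u + f i * v) + g₂ j l * (e' i * u + f' i * v))
        + (g₁ i l * (e j * u + f j * v) + g₂ i l * (e' j * u + f' j * v))
        - (g₁ i j * (e l * u + f l * v) + g₂ i j * (e' l * u + f' l * v)))) :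
    christoffel g = fun k i j x => c₀ k i j + c₁ k i j * U x + c₂ k i j * V x := by
  refine christoffel_eq_of_lowered hg _ fun i j l x => ?_
  simp only [hgU, h.partialDeriv_affine, hc]

theorem ricci_apply (h : IsDerivPair U V e f e' f') {g : TensorField n}
    {c₀ c₁ c₂ : Fin n → Matrix (Fin n) (Fin n) ℝ}
    (hΓ : christoffel g = fun k i j x => c₀ k i j + c₁ k i j * U x + c₂ k i j * V x)
    (x : Coord n) (i j : Fin n) : ricci g x i j =
      ∑ k, ((c₁ k i j * (e k * U x + f k * V x) + c₂ k i j * (e' k * U x + f' k * V x))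
        - (c₁ k i k * (e j * U x + f j * V x) + c₂ k i k * (e' j * U x + f' j * V x))) +
      ∑ k, ∑ l, ((c₀ k k l + c₁ k k l * U x + c₂ k k l * V x)
          * (c₀ l i j + c₁ l i j * U x + c₂ l i j * V x)
        - (c₀ k j l + c₁ k j l * U x + c₂ k j l * V x)
          * (c₀ l i k + c₁ l i k * U x + c₂ l i k * V x)) := by
  simp only [ricci, hΓ, Matrix.of_apply, h.partialDeriv_affine]

end IsDerivPair

/-! ### Constants -/

/-- `λ + 2 = -2((α - 1)² + β²)`. -/
theorem lamConst_add_two_neg (α β : ℝ) (hβ : β ≠ 0) : lamConst α β + 2 < 0 := by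
  have : 0 < β ^ 2 := by positivity
  unfold lamConst
  nlinarith [sq_nonneg (α - 1)]

theorem zConst_radicand_pos (α β m : ℝ) (hβ : β ≠ 0) (hm : 0 < m) :
    0 < -(lamConst α β * (m + 2) + 4) := by
  have := lamConst_add_two_neg α β hβ
  nlinarith

theorem zConst_pos (α β m : ℝ) (hβ : β ≠ 0) (hm : 0 < m) : 0 < zConst α β m := by
  have := Real.sqrt_pos.2 (zConst_radicand_pos α β m hβ hm)
  unfold zConst
  positivity

/-- The algebraic form in which the value of `z` enters: the later identities that tie `z`, `m` and
`λ` together are multiples of this one. -/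
theorem zConst_sq (α β m : ℝ) (hβ : β ≠ 0) (hm : 0 < m) :
    zConst α β m ^ 2 * (lamConst α β * (m + 2) + 4) = -4 := by
  have h := zConst_radicand_pos α β m hβ hm
  unfold zConst
  rw [div_pow, Real.sq_sqrt h.le, div_mul_eq_mul_div, div_eq_iff h.ne']
  ring

/-- This is `ρ = -tr F²`, the Ricci curvature in the direction `X₀`, because `tr B² = λ(λ + 2)/2`.
-/
theorem rhoConst_eq (α β m : ℝ) (hβ : β ≠ 0) (hm : 0 < m) :
    rhoConst α β m = -(zConst α β m ^ 2) * (lamConst α β * (lamConst α β + 2) / 2) := by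
  have h := zConst_radicand_pos α β m hβ hm
  have h' : lamConst α β * (m + 2) + 4 ≠ 0 := by linarith
  unfold rhoConst
  rw [div_eq_iff h']
  linear_combination (lamConst α β * (lamConst α β + 2) / 2) * zConst_sq α β m hβ hm

/-- The sign is forced by `λ < 0 < z`. As `r = s / z`, the factor `z` cancels and the potential
becomes `exp(-λs/2)`, independent of `m`. -/
theorem potential_slope (α β m : ℝ) (hβ : β ≠ 0) (hm : 0 < m) :
    Real.sqrt ((rhoConst α β m - lamConst α β) / m) = -(lamConst α β * zConst α β m / 2) := by
  have hz := zConst_pos α β m hβ hm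
  have hl := lamConst_add_two_neg α β hβ
  rw [Real.sqrt_eq_iff_mul_self_eq_of_pos (by nlinarith), rhoConst_eq α β m hβ hm,
    eq_div_iff hm.ne']
  linear_combination (lamConst α β / 4) * zConst_sq α β m hβ hm

/-! ### The metric on `G` -/

/-- The coefficient of `1` in `exp (-2 (s B + t A))`, as a function on `G`. -/
def gramOneG (α β : ℝ) (x : Coord 4) : ℝ := expCoeffOne α β (-2 * x 0) (-2 * x 1)

/-- The coefficient of `A` in `exp (-2 (s B + t A))`, as a function on `G`. -/
def gramAG (α β : ℝ) (x : Coord 4) : ℝ := expCoeffA α β (-2 * x 0) (-2 * x 1)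

theorem contDiff_gramOneG (α β : ℝ) : ContDiff ℝ ∞ (gramOneG α β) :=
  (contDiff_expCoeffOne α β).comp (f := fun x : Coord 4 => (-2 * x 0, -2 * x 1)) (by fun_prop)

theorem contDiff_gramAG (α β : ℝ) : ContDiff ℝ ∞ (gramAG α β) :=
  (contDiff_expCoeffA α β).comp (f := fun x : Coord 4 => (-2 * x 0, -2 * x 1)) (by fun_prop)

/-- The coefficients are those of the line derivatives in the directions `(a, b) = (-2, 0)` and `(0,
-2)`, the factor `-2` coming from the Gram matrix. -/
theorem isDerivPair_gramG (α β : ℝ) (hβ : β ≠ 0) :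
    IsDerivPair (gramOneG α β) (gramAG α β)
      ![-lamConst α β, 0, 0, 0] ![2 * detA α β, 2 * detA α β, 0, 0]
      ![-2, -2, 0, 0] ![-lamConst α β - 4, -4, 0, 0] where
  diff_left := (contDiff_gramOneG α β).differentiable (by simp)
  diff_right := (contDiff_gramAG α β).differentiable (by simp)
  deriv_left k x := by
    refine partialDeriv_eq_of_hasDerivAt
      ((contDiff_gramOneG α β).differentiable (by simp) x) ?_
    have h := hasDerivAt_expCoeffOne_line α β hβ (-2 * x 0) (-2 * x 1)
      (-2 * (Pi.single k 1 : Coord 4) 0) (-2 * (Pi.single k 1 : Coord 4) 1)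
    convert h using 1
    · funext s
      simp only [gramOneG, Pi.add_apply, Pi.smul_apply, smul_eq_mul]
      congr 1 <;> ring
    · fin_cases k <;> simp [gramOneG, gramAG] <;> ring
  deriv_right k x := by
    refine partialDeriv_eq_of_hasDerivAt
      ((contDiff_gramAG α β).differentiable (by simp) x) ?_
    have h := hasDerivAt_expCoeffA_line α β hβ (-2 * x 0) (-2 * x 1)
      (-2 * (Pi.single k 1 : Coord 4) 0) (-2 * (Pi.single k 1 : Coord 4) 1)
    convert h using 1
    · funext s
      simp only [gramAG, Pi.add_apply, Pi.smul_apply, smul_eq_mul]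
      congr 1 <;> ring
    · fin_cases k <;> simp [gramOneG, gramAG] <;> ring

theorem metricG_eq (α β m : ℝ) (hβ : β ≠ 0) (x : Coord 4) : metricG α β m x =
    !![(zConst α β m ^ 2)⁻¹, 0, 0, 0;
      0, 1, 0, 0;
      0, 0, gramOneG α β x + gramAG α β x * α, gramAG α β x * β;
      0, 0, gramAG α β x * β, gramOneG α β x + gramAG α β x * (2 - α)] := by
  unfold metricG
  rw [expBA_gram, expBA_eq α β hβ]
  simp [gramOneG, gramAG]

theorem isRiemannianMetric_metricG (α β m : ℝ) (hβ : β ≠ 0) (hm : 0 < m) :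
    IsRiemannianMetric (metricG α β m) where
  smooth i j := by
    have h1 := contDiff_gramOneG α β
    have h2 := contDiff_gramAG α β
    simp only [metricG_eq α β m hβ]
    fin_cases i <;> fin_cases j <;> simp <;> fun_prop
  posDef x := by
    have hz := zConst_pos α β m hβ hm
    -- `S` takes a tangent vector to its components in the orthonormal frame. Its left inverse `T`
    -- makes it injective, which gives definiteness of `SᵀS`.
    let S : Matrix (Fin 4) (Fin 4) ℝ :=
      !![(zConst α β m)⁻¹, 0, 0, 0; 0, 1, 0, 0;
        0, 0, expBA α β (-x 0) (-x 1) 0 0, expBA α β (-x 0) (-x 1) 0 1;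
        0, 0, expBA α β (-x 0) (-x 1) 1 0, expBA α β (-x 0) (-x 1) 1 1]
    let T : Matrix (Fin 4) (Fin 4) ℝ :=
      !![zConst α β m, 0, 0, 0; 0, 1, 0, 0;
        0, 0, expBA α β (x 0) (x 1) 0 0, expBA α β (x 0) (x 1) 0 1;
        0, 0, expBA α β (x 0) (x 1) 1 0, expBA α β (x 0) (x 1) 1 1]
    have hST : metricG α β m x = Sᴴ * S := by
      ext i j
      fin_cases i <;> fin_cases j <;>
        simp [metricG, S, Matrix.mul_apply, Fin.sum_univ_four, Fin.sum_univ_two, sq]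
    have hTS : T * S = 1 := by
      have h := expBA_mul_neg α β (x 0) (x 1)
      have h' := fun i j => congrFun (congrFun h i) j
      simp only [Matrix.mul_apply, Fin.sum_univ_two] at h'
      ext i j
      fin_cases i <;> fin_cases j <;>
        simp [T, S, Matrix.mul_apply, Fin.sum_univ_four, h', hz.ne']
    rw [hST]
    refine Matrix.PosDef.conjTranspose_mul_self S fun v w hvw => ?_
    have := congrArg (T *ᵥ ·) hvw
    simpa [Matrix.mulVec_mulVec, hTS] using this

/-- The constant parts of the Christoffel symbols of `metricG`. -/
def chrG₀ (α β : ℝ) : Fin 4 → Matrix (Fin 4) (Fin 4) ℝ :=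
  ![0, 0,
    !![0, 0, -(α + lamConst α β / 2), -β; 0, 0, -α, -β;
      -(α + lamConst α β / 2), -α, 0, 0; -β, -β, 0, 0],
    !![0, 0, -β, -(2 - α + lamConst α β / 2); 0, 0, -β, -(2 - α);
      -β, -β, 0, 0; -(2 - α + lamConst α β / 2), -(2 - α), 0, 0]]

/-- The coefficients of `gramOneG` in the Christoffel symbols of `metricG`. -/
def chrG₁ (α β m : ℝ) : Fin 4 → Matrix (Fin 4) (Fin 4) ℝ :=
  ![!![0, 0, 0, 0; 0, 0, 0, 0;
      0, 0, zConst α β m ^ 2 * (lamConst α β / 2 + α), zConst α β m ^ 2 * β;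
      0, 0, zConst α β m ^ 2 * β, zConst α β m ^ 2 * (lamConst α β / 2 + (2 - α))],
    !![0, 0, 0, 0; 0, 0, 0, 0; 0, 0, α, β; 0, 0, β, 2 - α], 0, 0]

/-- The coefficients of `gramAG` in the Christoffel symbols of `metricG`. -/
def chrG₂ (α β m : ℝ) : Fin 4 → Matrix (Fin 4) (Fin 4) ℝ :=
  ![!![0, 0, 0, 0; 0, 0, 0, 0;
      0, 0, zConst α β m ^ 2 * (-detA α β + (lamConst α β / 2 + 2) * α),
        zConst α β m ^ 2 * ((lamConst α β / 2 + 2) * β);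
      0, 0, zConst α β m ^ 2 * ((lamConst α β / 2 + 2) * β),
        zConst α β m ^ 2 * (-detA α β + (lamConst α β / 2 + 2) * (2 - α))],
    !![0, 0, 0, 0; 0, 0, 0, 0; 0, 0, -detA α β + 2 * α, 2 * β;
      0, 0, 2 * β, -detA α β + 2 * (2 - α)], 0, 0]

theorem vec4_apply {γ : Type*} (a b c d : γ) :
    ![a, b, c, d] 0 = a ∧ ![a, b, c, d] 1 = b ∧ ![a, b, c, d] 2 = c ∧ ![a, b, c, d] 3 = d :=
  ⟨rfl, rfl, rfl, rfl⟩

theorem mat4_apply (M : Fin 4 → Fin 4 → ℝ) (i j : Fin 4) : Matrix.of M i j = M i j := rfl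

/-- With fibre metric `P = U + VA` one has `∂₀P = -2BP` and `∂₁P = -2AP`. The mixed symbols with a
fibre upper index are therefore the constants `-B` and `-A`, while the fibre-fibre symbols are
`z²BP` and `AP`, expanded by Cayley-Hamilton. -/
theorem christoffel_metricG (α β m : ℝ) (hβ : β ≠ 0) (hm : 0 < m) :
    christoffel (metricG α β m) = fun k i j x => chrG₀ α β k i j
      + chrG₁ α β m k i j * gramOneG α β x + chrG₂ α β m k i j * gramAG α β x := by
  have hz := (zConst_pos α β m hβ hm).ne'
  refine (isDerivPair_gramG α β hβ).christoffel_eq (isRiemannianMetric_metricG α β m hβ hm)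
    (g₀ := !![(zConst α β m ^ 2)⁻¹, 0, 0, 0; 0, 1, 0, 0; 0, 0, 0, 0; 0, 0, 0, 0])
    (g₁ := !![0, 0, 0, 0; 0, 0, 0, 0; 0, 0, 1, 0; 0, 0, 0, 1])
    (g₂ := !![0, 0, 0, 0; 0, 0, 0, 0; 0, 0, α, β; 0, 0, β, 2 - α]) ?_ _ _ _ ?_
  · intro x i j
    rw [metricG_eq α β m hβ]
    fin_cases i <;> fin_cases j <;> simp <;> ring
  · intro i j l u v
    fin_cases i <;> fin_cases j <;> fin_cases l <;>
      simp only [chrG₀, chrG₁, chrG₂, Fin.sum_univ_four, Fin.zero_eta, Fin.mk_one,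
        Fin.reduceFinMk, vec4_apply, mat4_apply, Matrix.zero_apply, detA] <;>
      first | ring1 | (field_simp; ring1)

theorem matB_apply (α β : ℝ) :
    matB α β 0 0 = α + lamConst α β / 2 ∧ matB α β 0 1 = β ∧ matB α β 1 0 = β ∧
      matB α β 1 1 = 2 - α + lamConst α β / 2 := by
  simp [matB, matA]

/-- The constant endomorphism field which is the Ricci curvature of `metricG`. -/
def ricciMatG (α β m : ℝ) : Matrix (Fin 4) (Fin 4) ℝ :=
  lamConst α β • 1 + !![rhoConst α β m - lamConst α β, 0, 0, 0; 0, 0, 0, 0;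
    0, 0, lamConst α β * m * zConst α β m ^ 2 / 2 * matB α β 0 0,
      lamConst α β * m * zConst α β m ^ 2 / 2 * matB α β 0 1;
    0, 0, lamConst α β * m * zConst α β m ^ 2 / 2 * matB α β 1 0,
      lamConst α β * m * zConst α β m ^ 2 / 2 * matB α β 1 1]

/-- The base block is `-tr F²`, `-tr FA = 0`, `-tr A² = λ`. The fibre block is `-(tr F)F - (tr A)A =
-z²(λ + 2)B - 2A`, and `-2A = λ - 2B`. -/
theorem ricci_metricG (α β m : ℝ) (hβ : β ≠ 0) (hm : 0 < m) (x : Coord 4) :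
    ricci (metricG α β m) x = metricG α β m x * ricciMatG α β m := by
  have hz := (zConst_pos α β m hβ hm).ne'
  have h2 : lamConst α β * m * zConst α β m ^ 2 / 2 =
      -(zConst α β m ^ 2 * (2 + lamConst α β) + 2) := by
    linear_combination (1 / 2) * zConst_sq α β m hβ hm
  ext i j
  rw [(isDerivPair_gramG α β hβ).ricci_apply (christoffel_metricG α β m hβ hm),
    metricG_eq α β m hβ]
  simp only [ricciMatG, rhoConst_eq α β m hβ hm, h2]
  generalize gramOneG α β x = u
  generalize gramAG α β x = v
  fin_cases i <;> fin_cases j <;>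
    simp only [chrG₀, chrG₁, chrG₂, Fin.sum_univ_four, Fin.zero_eta, Fin.mk_one,
      Fin.reduceFinMk, vec4_apply, mat4_apply, Matrix.zero_apply, detA, Matrix.mul_apply,
      Matrix.add_apply, Matrix.smul_apply, smul_eq_mul, Matrix.one_apply, Fin.reduceEq, if_true,
      if_false, matB_apply] <;>
    first | (simp only [lamConst]; ring1) | (field_simp; simp only [lamConst]; ring1)

/-! ### The potential function -/

theorem potentialG_eq (α β m : ℝ) (hβ : β ≠ 0) (hm : 0 < m) :
    potentialG α β m = fun x => Real.exp (-(lamConst α β / 2) * x 0) := by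
  have hz := (zConst_pos α β m hβ hm).ne'
  funext x
  unfold potentialG
  rw [potential_slope α β m hβ hm]
  congr 1
  field_simp

theorem partialDeriv_exp_mul {n : ℕ} (c d : ℝ) (i j : Fin n) (x : Coord n) :
    partialDeriv i (fun y => d * Real.exp (c * y j)) x =
      (if j = i then c else 0) * d * Real.exp (c * x j) := by
  have h1 : HasFDerivAt (fun y : Coord n => y j) (ContinuousLinearMap.proj j) x :=
    (ContinuousLinearMap.proj (R := ℝ) (φ := fun _ : Fin n => ℝ) j).hasFDerivAt
  have h := ((h1.const_mul c).exp).const_mul d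
  unfold partialDeriv
  rw [h.fderiv]
  by_cases hij : j = i
  · subst hij
    simp
    ring
  · simp [hij]

theorem rhoConst_sub (α β m : ℝ) (hβ : β ≠ 0) (hm : 0 < m) :
    rhoConst α β m - lamConst α β = m * (zConst α β m ^ 2 * lamConst α β ^ 2 / 4) := by
  rw [rhoConst_eq α β m hβ hm]
  linear_combination (-(lamConst α β) / 4) * zConst_sq α β m hβ hm

/-- The endomorphism field `(m / w) ∇∇w`, which is constant in coordinates. -/
def hessMatG (α β m : ℝ) : Matrix (Fin 4) (Fin 4) ℝ :=
  !![rhoConst α β m - lamConst α β, 0, 0, 0; 0, 0, 0, 0;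
    0, 0, lamConst α β * m * zConst α β m ^ 2 / 2 * matB α β 0 0,
      lamConst α β * m * zConst α β m ^ 2 / 2 * matB α β 0 1;
    0, 0, lamConst α β * m * zConst α β m ^ 2 / 2 * matB α β 1 0,
      lamConst α β * m * zConst α β m ^ 2 / 2 * matB α β 1 1]

theorem ricciMatG_eq (α β m : ℝ) :
    ricciMatG α β m = lamConst α β • 1 + hessMatG α β m := rfl

/-- `w` is a function of `r` with `w' = -(λz/2)w`. Along `X₀` the Hessian gives `w'' = (λz/2)²w`; on
the fibre `∇∇r = -F`, which contributes `(λz²/2)wB`; along `X₁` it vanishes. -/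
theorem hessian_potentialG (α β m : ℝ) (hβ : β ≠ 0) (hm : 0 < m) (x : Coord 4) :
    hessian (metricG α β m) (potentialG α β m) x =
      (potentialG α β m x / m) • (metricG α β m x * hessMatG α β m) := by
  have hz := (zConst_pos α β m hβ hm).ne'
  have h1 : ∀ i, partialDeriv i (potentialG α β m) = fun y =>
      (if 0 = i then -(lamConst α β / 2) else 0) * Real.exp (-(lamConst α β / 2) * y 0) := by
    intro i
    funext y
    rw [potentialG_eq α β m hβ hm]
    simpa using partialDeriv_exp_mul (-(lamConst α β / 2)) 1 i 0 y
  ext i j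
  simp only [hessian, Matrix.of_apply, h1, partialDeriv_exp_mul,
    christoffel_metricG α β m hβ hm]
  rw [potentialG_eq α β m hβ hm, metricG_eq α β m hβ]
  simp only [hessMatG, rhoConst_sub α β m hβ hm]
  generalize Real.exp (-(lamConst α β / 2) * x 0) = w
  generalize gramOneG α β x = u
  generalize gramAG α β x = v
  fin_cases i <;> fin_cases j <;>
    simp only [chrG₀, chrG₁, chrG₂, Fin.sum_univ_four, Fin.zero_eta, Fin.mk_one,
      Fin.reduceFinMk, vec4_apply, mat4_apply, Matrix.zero_apply, detA, Matrix.mul_apply,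
      Matrix.smul_apply, smul_eq_mul, Fin.reduceEq, if_true, if_false, matB_apply] <;>
    first | ring1 | (field_simp; ring1)

theorem hess_eq_ricci_sub (α β m : ℝ) (hβ : β ≠ 0) (hm : 0 < m) (x : Coord 4) :
    hessian (metricG α β m) (potentialG α β m) x =
      (potentialG α β m x / m) • (ricci (metricG α β m) x - lamConst α β • metricG α β m x) := by
  rw [hessian_potentialG α β m hβ hm, ricci_metricG α β m hβ hm, ricciMatG_eq, Matrix.mul_add,
    Matrix.mul_smul, Matrix.mul_one, add_sub_cancel_left]

theorem hessianEndo_potentialG (α β m : ℝ) (hβ : β ≠ 0) (hm : 0 < m) (x : Coord 4) :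
    hessianEndo (metricG α β m) (potentialG α β m) x =
      (potentialG α β m x / m) • hessMatG α β m := by
  have hdet : IsUnit (metricG α β m x).det := (Matrix.isUnit_iff_isUnit_det _).1
    ((isRiemannianMetric_metricG α β m hβ hm).posDef x).isUnit
  rw [hessianEndo, hessian_potentialG α β m hβ hm, Matrix.mul_smul, ← Matrix.mul_assoc,
    Matrix.nonsing_inv_mul _ hdet, Matrix.one_mul]

/-- The trace of `hessMatG` at `m = 1` is `z²λ²/4 + (λz²/2)(λ + 2) = (λ/4)z²(3λ + 4)`, and here
`z²(3λ + 4) = -4`. -/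
theorem laplacian_potentialG (α β : ℝ) (hβ : β ≠ 0) (x : Coord 4) :
    laplacian (metricG α β 1) (potentialG α β 1) x = -lamConst α β * potentialG α β 1 x := by
  rw [laplacian, hessianEndo_potentialG α β 1 hβ one_pos, Matrix.trace_smul, hessMatG,
    rhoConst_sub α β 1 hβ one_pos]
  simp only [Matrix.trace, Fin.sum_univ_four, Matrix.diag_apply, mat4_apply, vec4_apply,
    matB_apply, smul_eq_mul]
  linear_combination (lamConst α β * potentialG α β 1 x / 4) * zConst_sq α β 1 hβ one_pos

theorem contDiff_potentialG (α β m : ℝ) : ContDiff ℝ ∞ (potentialG α β m) := by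
  unfold potentialG
  fun_prop

/-! ### The metric on `H` -/

/-- The coefficient of `1` in `exp (-2 t A)`, as a function on `H`. -/
def gramOneH (α β : ℝ) (x : Coord 3) : ℝ := expCoeffOne α β 0 (-2 * x 0)

/-- The coefficient of `A` in `exp (-2 t A)`, as a function on `H`. -/
def gramAH (α β : ℝ) (x : Coord 3) : ℝ := expCoeffA α β 0 (-2 * x 0)

theorem contDiff_gramOneH (α β : ℝ) : ContDiff ℝ ∞ (gramOneH α β) :=
  (contDiff_expCoeffOne α β).comp (f := fun x : Coord 3 => ((0 : ℝ), -2 * x 0)) (by fun_prop)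

theorem contDiff_gramAH (α β : ℝ) : ContDiff ℝ ∞ (gramAH α β) :=
  (contDiff_expCoeffA α β).comp (f := fun x : Coord 3 => ((0 : ℝ), -2 * x 0)) (by fun_prop)

theorem isDerivPair_gramH (α β : ℝ) (hβ : β ≠ 0) :
    IsDerivPair (gramOneH α β) (gramAH α β)
      ![0, 0, 0] ![2 * detA α β, 0, 0] ![-2, 0, 0] ![-4, 0, 0] where
  diff_left := (contDiff_gramOneH α β).differentiable (by simp)
  diff_right := (contDiff_gramAH α β).differentiable (by simp)
  deriv_left k x := by
    refine partialDeriv_eq_of_hasDerivAt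
      ((contDiff_gramOneH α β).differentiable (by simp) x) ?_
    have h := hasDerivAt_expCoeffOne_line α β hβ 0 (-2 * x 0) 0 (-2 * (Pi.single k 1 : Coord 3) 0)
    convert h using 1
    · funext s
      simp only [gramOneH, Pi.add_apply, Pi.smul_apply, smul_eq_mul]
      congr 1 <;> ring
    · fin_cases k <;> simp [gramOneH, gramAH]
      ring
  deriv_right k x := by
    refine partialDeriv_eq_of_hasDerivAt
      ((contDiff_gramAH α β).differentiable (by simp) x) ?_
    have h := hasDerivAt_expCoeffA_line α β hβ 0 (-2 * x 0) 0 (-2 * (Pi.single k 1 : Coord 3) 0)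
    convert h using 1
    · funext s
      simp only [gramAH, Pi.add_apply, Pi.smul_apply, smul_eq_mul]
      congr 1 <;> ring
    · fin_cases k <;> simp [gramOneH, gramAH]
      ring

theorem metricH_eq (α β : ℝ) (hβ : β ≠ 0) (x : Coord 3) : metricH α β x =
    !![1, 0, 0;
      0, gramOneH α β x + gramAH α β x * α, gramAH α β x * β;
      0, gramAH α β x * β, gramOneH α β x + gramAH α β x * (2 - α)] := by
  have h := expBA_gram α β 0 (x 0)
  rw [neg_zero, mul_zero] at h
  unfold metricH
  rw [h, expBA_eq α β hβ]
  simp [gramOneH, gramAH]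

theorem isRiemannianMetric_metricH (α β : ℝ) (hβ : β ≠ 0) :
    IsRiemannianMetric (metricH α β) where
  smooth i j := by
    have h1 := contDiff_gramOneH α β
    have h2 := contDiff_gramAH α β
    simp only [metricH_eq α β hβ]
    fin_cases i <;> fin_cases j <;> simp <;> fun_prop
  posDef x := by
    let S : Matrix (Fin 3) (Fin 3) ℝ :=
      !![1, 0, 0; 0, expBA α β 0 (-x 0) 0 0, expBA α β 0 (-x 0) 0 1;
        0, expBA α β 0 (-x 0) 1 0, expBA α β 0 (-x 0) 1 1]
    let T : Matrix (Fin 3) (Fin 3) ℝ :=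
      !![1, 0, 0; 0, expBA α β 0 (x 0) 0 0, expBA α β 0 (x 0) 0 1;
        0, expBA α β 0 (x 0) 1 0, expBA α β 0 (x 0) 1 1]
    have hST : metricH α β x = Sᴴ * S := by
      ext i j
      fin_cases i <;> fin_cases j <;>
        simp [metricH, S, Matrix.mul_apply, Fin.sum_univ_three, Fin.sum_univ_two]
    have hTS : T * S = 1 := by
      have h := expBA_mul_neg α β 0 (x 0)
      rw [neg_zero] at h
      have h' := fun i j => congrFun (congrFun h i) j
      simp only [Matrix.mul_apply, Fin.sum_univ_two] at h'
      ext i j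
      fin_cases i <;> fin_cases j <;>
        simp [T, S, Matrix.mul_apply, Fin.sum_univ_three, h']
    rw [hST]
    refine Matrix.PosDef.conjTranspose_mul_self S fun v w hvw => ?_
    have := congrArg (T *ᵥ ·) hvw
    simpa [Matrix.mulVec_mulVec, hTS] using this

/-- The constant parts of the Christoffel symbols of `metricH`. -/
def chrH₀ (α β : ℝ) : Fin 3 → Matrix (Fin 3) (Fin 3) ℝ :=
  ![0, !![0, -α, -β; -α, 0, 0; -β, 0, 0], !![0, -β, -(2 - α); -β, 0, 0; -(2 - α), 0, 0]]

/-- The coefficients of `gramOneH` in the Christoffel symbols of `metricH`. -/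
def chrH₁ (α β : ℝ) : Fin 3 → Matrix (Fin 3) (Fin 3) ℝ :=
  ![!![0, 0, 0; 0, α, β; 0, β, 2 - α], 0, 0]

/-- The coefficients of `gramAH` in the Christoffel symbols of `metricH`. -/
def chrH₂ (α β : ℝ) : Fin 3 → Matrix (Fin 3) (Fin 3) ℝ :=
  ![!![0, 0, 0; 0, -detA α β + 2 * α, 2 * β; 0, 2 * β, -detA α β + 2 * (2 - α)], 0, 0]

theorem vec3_apply {γ : Type*} (a b c : γ) :
    ![a, b, c] 0 = a ∧ ![a, b, c] 1 = b ∧ ![a, b, c] 2 = c :=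
  ⟨rfl, rfl, rfl⟩

theorem mat3_apply (M : Fin 3 → Fin 3 → ℝ) (i j : Fin 3) : Matrix.of M i j = M i j := rfl

theorem christoffel_metricH (α β : ℝ) (hβ : β ≠ 0) :
    christoffel (metricH α β) = fun k i j x => chrH₀ α β k i j
      + chrH₁ α β k i j * gramOneH α β x + chrH₂ α β k i j * gramAH α β x := by
  refine (isDerivPair_gramH α β hβ).christoffel_eq (isRiemannianMetric_metricH α β hβ)
    (g₀ := !![1, 0, 0; 0, 0, 0; 0, 0, 0])
    (g₁ := !![0, 0, 0; 0, 1, 0; 0, 0, 1])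
    (g₂ := !![0, 0, 0; 0, α, β; 0, β, 2 - α]) ?_ _ _ _ ?_
  · intro x i j
    rw [metricH_eq α β hβ]
    fin_cases i <;> fin_cases j <;> simp <;> ring
  · intro i j l u v
    fin_cases i <;> fin_cases j <;> fin_cases l <;>
      simp only [chrH₀, chrH₁, chrH₂, Fin.sum_univ_three, Fin.zero_eta, Fin.mk_one,
        Fin.reduceFinMk, vec3_apply, mat3_apply, Matrix.zero_apply, detA] <;>
      ring1

/-- The matrix of the derivation `D = 0 ⊕ (-2 A - λ I)`. -/
def derivMatH (α β : ℝ) : Matrix (Fin 3) (Fin 3) ℝ :=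
  !![0, 0, 0; 0, -2 * α - lamConst α β, -2 * β; 0, -2 * β, -2 * (2 - α) - lamConst α β]

/-- Here `Ric` is `-tr A² = λ` on `∂ₜ` and `-(tr A)A = -2A` on the fibre. -/
theorem ricci_metricH (α β : ℝ) (hβ : β ≠ 0) (x : Coord 3) :
    ricci (metricH α β) x = metricH α β x * (lamConst α β • 1 + derivMatH α β) := by
  ext i j
  rw [(isDerivPair_gramH α β hβ).ricci_apply (christoffel_metricH α β hβ), metricH_eq α β hβ]
  generalize gramOneH α β x = u
  generalize gramAH α β x = v
  fin_cases i <;> fin_cases j <;>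
    simp only [chrH₀, chrH₁, chrH₂, derivMatH, Fin.sum_univ_three, Fin.zero_eta, Fin.mk_one,
      Fin.reduceFinMk, vec3_apply, mat3_apply, Matrix.zero_apply, detA, Matrix.mul_apply,
      Matrix.add_apply, Matrix.smul_apply, smul_eq_mul, Matrix.one_apply, Fin.reduceEq, if_true,
      if_false] <;>
    simp only [lamConst] <;> ring1

theorem ricciEndo_metricH (α β : ℝ) (hβ : β ≠ 0) (x : Coord 3) :
    ricciEndo (metricH α β) x = lamConst α β • 1 + derivMatH α β := by
  have hdet : IsUnit (metricH α β x).det := (Matrix.isUnit_iff_isUnit_det _).1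
    ((isRiemannianMetric_metricH α β hβ).posDef x).isUnit
  rw [ricciEndo, ricci_metricH α β hβ, ← Matrix.mul_assoc, Matrix.nonsing_inv_mul _ hdet,
    Matrix.one_mul]

theorem not_isEinstein_metricH (α β : ℝ) (hβ : β ≠ 0) : ¬ IsEinstein (metricH α β) := by
  rintro ⟨c, hc⟩
  have hdet : IsUnit (metricH α β 0).det := (Matrix.isUnit_iff_isUnit_det _).1
    ((isRiemannianMetric_metricH α β hβ).posDef 0).isUnit
  have h := ricciEndo_metricH α β hβ 0
  rw [ricciEndo, hc, Matrix.mul_smul, Matrix.nonsing_inv_mul _ hdet] at h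
  -- An off-diagonal entry: zero for a multiple of the identity, `-2β` for the Ricci endomorphism.
  have h' := congrFun (congrFun h 1) 2
  simp [derivMatH] at h'
  exact hβ h'

/-! ### Left translations -/

theorem hasFDerivAt_add_mulVec {n : ℕ} (c : Coord n) (M : Matrix (Fin n) (Fin n) ℝ) (x : Coord n) :
    HasFDerivAt (fun y => c + M *ᵥ y) (LinearMap.toContinuousLinearMap (Matrix.toLin' M)) x :=
  (LinearMap.toContinuousLinearMap (Matrix.toLin' M)).hasFDerivAt.const_add c

theorem jacobian_add_mulVec {n : ℕ} (c : Coord n) (M : Matrix (Fin n) (Fin n) ℝ) (x : Coord n) :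
    jacobian (fun y => c + M *ᵥ y) x = M := by
  unfold jacobian
  rw [(hasFDerivAt_add_mulVec c M x).fderiv]
  simp

/-- The linear part of the left translation by `x` in `G`. -/
def transG (α β : ℝ) (x : Coord 4) : Matrix (Fin 4) (Fin 4) ℝ :=
  !![1, 0, 0, 0; 0, 1, 0, 0;
    0, 0, expBA α β (x 0) (x 1) 0 0, expBA α β (x 0) (x 1) 0 1;
    0, 0, expBA α β (x 0) (x 1) 1 0, expBA α β (x 0) (x 1) 1 1]

/-- The linear part of the left translation by `x` in `H`. -/
def transH (α β : ℝ) (x : Coord 3) : Matrix (Fin 3) (Fin 3) ℝ :=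
  !![1, 0, 0; 0, expBA α β 0 (x 0) 0 0, expBA α β 0 (x 0) 0 1;
    0, expBA α β 0 (x 0) 1 0, expBA α β 0 (x 0) 1 1]

/-- Left translations are affine in these coordinates, so their Jacobian does not depend on the
point. -/
theorem lawG_mul (α β : ℝ) (x : Coord 4) :
    (lawG α β).mul x = fun y => x + transG α β x *ᵥ y := by
  funext y i
  fin_cases i <;>
    simp [lawG, transG, Matrix.mulVec, dotProduct, Fin.sum_univ_four, Fin.sum_univ_two]

theorem lawH_mul (α β : ℝ) (x : Coord 3) :
    (lawH α β).mul x = fun y => x + transH α β x *ᵥ y := by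
  funext y i
  fin_cases i <;>
    simp [lawH, transH, Matrix.mulVec, dotProduct, Fin.sum_univ_three, Fin.sum_univ_two]

theorem expBA_left_invariance (α β s t s' t' : ℝ) :
    (expBA α β s t)ᵀ * ((expBA α β (-(s + s')) (-(t + t')))ᵀ * expBA α β (-(s + s')) (-(t + t')))
      * expBA α β s t = (expBA α β (-s') (-t'))ᵀ * expBA α β (-s') (-t') := by
  simp only [expBA_transpose, ← expBA_add]
  congr 1 <;> ring

theorem isLeftInvariant_metricG (α β m : ℝ) : (lawG α β).IsLeftInvariant (metricG α β m) := by
  intro a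
  funext x
  have h := expBA_left_invariance α β (a 0) (a 1) (x 0) (x 1)
  have h' := fun i j => congrFun (congrFun h i) j
  unfold pullback
  rw [lawG_mul, jacobian_add_mulVec]
  have e0 : (a + transG α β a *ᵥ x) 0 = a 0 + x 0 := by
    simp [transG, dotProduct, Fin.sum_univ_four]
  have e1 : (a + transG α β a *ᵥ x) 1 = a 1 + x 1 := by
    simp [transG, dotProduct, Fin.sum_univ_four]
  simp only [metricG, e0, e1]
  generalize (expBA α β (-(a 0 + x 0)) (-(a 1 + x 1)))ᵀ *
    expBA α β (-(a 0 + x 0)) (-(a 1 + x 1)) = P at *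
  generalize (expBA α β (-x 0) (-x 1))ᵀ * expBA α β (-x 0) (-x 1) = Q at *
  simp only [Matrix.mul_apply, Fin.sum_univ_two, Matrix.transpose_apply] at h'
  ext i j
  fin_cases i <;> fin_cases j <;>
    simp [transG, Matrix.mul_apply, Fin.sum_univ_four, h']

theorem isLeftInvariant_metricH (α β : ℝ) : (lawH α β).IsLeftInvariant (metricH α β) := by
  intro a
  funext x
  have h := expBA_left_invariance α β 0 (a 0) 0 (x 0)
  rw [zero_add, neg_zero] at h
  have h' := fun i j => congrFun (congrFun h i) j
  unfold pullback
  rw [lawH_mul, jacobian_add_mulVec]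
  have e0 : (a + transH α β a *ᵥ x) 0 = a 0 + x 0 := by
    simp [transH, dotProduct, Fin.sum_univ_three]
  simp only [metricH, e0]
  generalize (expBA α β 0 (-(a 0 + x 0)))ᵀ * expBA α β 0 (-(a 0 + x 0)) = P at *
  generalize (expBA α β 0 (-x 0))ᵀ * expBA α β 0 (-x 0) = Q at *
  simp only [Matrix.mul_apply, Fin.sum_univ_two, Matrix.transpose_apply] at h'
  ext i j
  fin_cases i <;> fin_cases j <;>
    simp [transH, Matrix.mul_apply, Fin.sum_univ_three, h']

theorem innerAtOne_frameG (α β m : ℝ) (hβ : β ≠ 0) (hm : 0 < m) (i j : Fin 4) :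
    (lawG α β).innerAtOne (metricG α β m) (frameG α β m i) (frameG α β m j) =
      if i = j then 1 else 0 := by
  have hz := (zConst_pos α β m hβ hm).ne'
  have h1 : (lawG α β).one = 0 := rfl
  have h2 : metricG α β m 0 =
      !![(zConst α β m ^ 2)⁻¹, 0, 0, 0; 0, 1, 0, 0; 0, 0, 1, 0; 0, 0, 0, 1] := by
    simp [metricG, expBA_zero]
  unfold LieLaw.innerAtOne
  rw [h1, h2]
  fin_cases i <;> fin_cases j <;>
    simp [frameG, Matrix.mulVec, dotProduct, Fin.sum_univ_four]
  field_simp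

/-! ### Solvability -/

/-- The projection to `(s, t)` has abelian target, and its kernel is abelian because the action is
trivial at `s = t = 0`. -/
theorem isSolvable_lawG (α β : ℝ) : Group.IsSolvable (lawG α β).Carrier := by
  let g : (lawG α β).Carrier →* Multiplicative (ℝ × ℝ) :=
    MonoidHom.mk' (fun x => Multiplicative.ofAdd ((x : Coord 4) 0, (x : Coord 4) 1))
      fun x y => rfl
  have hk : Group.IsSolvable g.ker := by
    refine Group.isSolvable_of_comm fun a b => Subtype.ext ?_
    have key : ∀ x : g.ker, (x.1 : Coord 4) 0 = 0 ∧ (x.1 : Coord 4) 1 = 0 := fun x =>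
      Prod.ext_iff.1 (Multiplicative.ofAdd.injective (MonoidHom.mem_ker.1 x.2))
    obtain ⟨a0, a1⟩ := key a
    obtain ⟨b0, b1⟩ := key b
    change (lawG α β).mul a.1 b.1 = (lawG α β).mul b.1 a.1
    funext i
    fin_cases i <;> simp [lawG, a0, a1, b0, b1, expBA_zero, add_comm]
  exact Group.isSolvable_of_ker_le_range g.ker.subtype g (by simp)

theorem isSolvable_lawH (α β : ℝ) : Group.IsSolvable (lawH α β).Carrier := by
  let g : (lawH α β).Carrier →* Multiplicative ℝ :=
    MonoidHom.mk' (fun x => Multiplicative.ofAdd ((x : Coord 3) 0)) fun x y => rfl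
  have hk : Group.IsSolvable g.ker := by
    refine Group.isSolvable_of_comm fun a b => Subtype.ext ?_
    have key : ∀ x : g.ker, (x.1 : Coord 3) 0 = 0 := fun x =>
      Multiplicative.ofAdd.injective (MonoidHom.mem_ker.1 x.2)
    have a0 := key a
    have b0 := key b
    change (lawH α β).mul a.1 b.1 = (lawH α β).mul b.1 a.1
    funext i
    fin_cases i <;> simp [lawH, a0, b0, expBA_zero, add_comm]
  exact Group.isSolvable_of_ker_le_range g.ker.subtype g (by simp)

/-! ### Lie brackets -/

theorem mlieBracket_eq_lieBracket {E : Type*} [NormedAddCommGroup E] [NormedSpace ℝ E]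
    (V W : E → E) (x : E) :
    (VectorField.mlieBracket 𝓘(ℝ, E) V W x : E) = VectorField.lieBracket ℝ V W x := by
  have h := VectorField.mlieBracketWithin_eq_lieBracketWithin (𝕜 := ℝ) (V := V) (W := W)
    (s := Set.univ)
  have h' := VectorField.mlieBracketWithin_univ (I := 𝓘(ℝ, E)) (V := V) (W := W)
  exact (congrFun h' x).symm.trans
    ((congrFun h x).trans (congrFun VectorField.lieBracketWithin_univ x))

/-- The bracket of the Lie algebra, in terms of coordinate vectors. -/
def LieLaw.lie {n : ℕ} (L : LieLaw n) (u v : Coord n) : Coord n :=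
  @Bracket.bracket L.LieAlg L.LieAlg _ u v

/-- The Lie algebra bracket is that of left invariant vector fields; on the manifold `ℝⁿ` the
manifold derivative and bracket are the ordinary ones. -/
theorem LieLaw.lie_eq {n : ℕ} (L : LieLaw n) (u v : Coord n) :
    L.lie u v = VectorField.lieBracket ℝ
      (fun x : Coord n => fderiv ℝ (L.mul x) L.one u)
      (fun x : Coord n => fderiv ℝ (L.mul x) L.one v) L.one := by
  have e : ∀ x, (mfderiv 𝓘(ℝ, Coord n) 𝓘(ℝ, Coord n) (L.mul x) L.one : Coord n →L[ℝ] Coord n) =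
      fderiv ℝ (L.mul x) L.one := fun x => mfderiv_eq_fderiv
  have h := mlieBracket_eq_lieBracket
    (fun x : Coord n =>
      (mfderiv 𝓘(ℝ, Coord n) 𝓘(ℝ, Coord n) (L.mul x) L.one : Coord n →L[ℝ] Coord n) u)
    (fun x : Coord n =>
      (mfderiv 𝓘(ℝ, Coord n) 𝓘(ℝ, Coord n) (L.mul x) L.one : Coord n →L[ℝ] Coord n) v) L.one
  simp only [e] at h
  refine Eq.trans ?_ h
  simp only [← e]
  rfl

/-- The differential at the identity of the left invariant field on `G` with value `v`. -/
theorem fderiv_transG_mulVec (α β : ℝ) (u v : Coord 4) :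
    fderiv ℝ (fun x => transG α β x *ᵥ v) 0 u =
      ![0, 0, ((u 0 • matB α β + u 1 • matA α β) *ᵥ ![v 2, v 3]) 0,
        ((u 0 • matB α β + u 1 • matA α β) *ᵥ ![v 2, v 3]) 1] := by
  have e : ∀ i j, ContDiff ℝ ∞ fun p : Coord 4 => expBA α β (p 0) (p 1) i j := fun i j =>
    (contDiff_expBA α β i j).comp (f := fun p : Coord 4 => (p 0, p 1)) (by fun_prop)
  have hd : DifferentiableAt ℝ (fun x => transG α β x *ᵥ v) 0 := by
    refine ContDiffAt.differentiableAt (n := ∞) (ContDiff.contDiffAt ?_) (by simp)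
    rw [contDiff_pi]
    intro i
    fin_cases i <;> simp [transG, Matrix.mulVec, dotProduct, Fin.sum_univ_four] <;> fun_prop
  rw [← hd.lineDeriv_eq_fderiv]
  refine HasDerivAt.deriv ?_
  rw [hasDerivAt_pi]
  have d := hasDerivAt_expBA_line α β 0 0 (u 0) (u 1)
  simp only [expBA_zero, mul_one, zero_add] at d
  intro i
  fin_cases i <;> simp [transG, Matrix.mulVec, dotProduct, Fin.sum_univ_four, Fin.sum_univ_two]
  · exact hasDerivAt_const _ _
  · exact hasDerivAt_const _ _
  · exact ((d 0 0).mul_const _).add ((d 0 1).mul_const _)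
  · exact ((d 1 0).mul_const _).add ((d 1 1).mul_const _)

theorem fderiv_transH_mulVec (α β : ℝ) (u v : Coord 3) :
    fderiv ℝ (fun x => transH α β x *ᵥ v) 0 u =
      ![0, ((u 0 • matA α β) *ᵥ ![v 1, v 2]) 0, ((u 0 • matA α β) *ᵥ ![v 1, v 2]) 1] := by
  have e : ∀ i j, ContDiff ℝ ∞ fun p : Coord 3 => expBA α β 0 (p 0) i j := fun i j =>
    (contDiff_expBA α β i j).comp (f := fun p : Coord 3 => ((0 : ℝ), p 0)) (by fun_prop)
  have hd : DifferentiableAt ℝ (fun x => transH α β x *ᵥ v) 0 := by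
    refine ContDiffAt.differentiableAt (n := ∞) (ContDiff.contDiffAt ?_) (by simp)
    rw [contDiff_pi]
    intro i
    fin_cases i <;> simp [transH, Matrix.mulVec, dotProduct, Fin.sum_univ_three] <;> fun_prop
  rw [← hd.lineDeriv_eq_fderiv]
  refine HasDerivAt.deriv ?_
  rw [hasDerivAt_pi]
  have d := hasDerivAt_expBA_line α β 0 0 0 (u 0)
  simp only [expBA_zero, mul_one, mul_zero, zero_add, zero_smul] at d
  intro i
  fin_cases i <;> simp [transH, Matrix.mulVec, dotProduct, Fin.sum_univ_three, Fin.sum_univ_two]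
  · exact hasDerivAt_const _ _
  · exact ((d 0 0).mul_const _).add ((d 0 1).mul_const _)
  · exact ((d 1 0).mul_const _).add ((d 1 1).mul_const _)

theorem fderiv_lawG_mul (α β : ℝ) (x y v : Coord 4) :
    fderiv ℝ ((lawG α β).mul x) y v = transG α β x *ᵥ v := by
  rw [lawG_mul, (hasFDerivAt_add_mulVec x _ y).fderiv]
  rfl

theorem fderiv_lawH_mul (α β : ℝ) (x y v : Coord 3) :
    fderiv ℝ ((lawH α β).mul x) y v = transH α β x *ᵥ v := by
  rw [lawH_mul, (hasFDerivAt_add_mulVec x _ y).fderiv]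
  rfl

theorem transG_zero (α β : ℝ) : transG α β 0 = 1 := by
  ext i j
  fin_cases i <;> fin_cases j <;> simp [transG, expBA_zero]

theorem transH_zero (α β : ℝ) : transH α β 0 = 1 := by
  ext i j
  fin_cases i <;> fin_cases j <;> simp [transH, expBA_zero]

theorem lie_lawG (α β : ℝ) (u v : Coord 4) :
    (lawG α β).lie u v =
      ![0, 0, ((u 0 • matB α β + u 1 • matA α β) *ᵥ ![v 2, v 3]) 0,
        ((u 0 • matB α β + u 1 • matA α β) *ᵥ ![v 2, v 3]) 1] -
      ![0, 0, ((v 0 • matB α β + v 1 • matA α β) *ᵥ ![u 2, u 3]) 0,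
        ((v 0 • matB α β + v 1 • matA α β) *ᵥ ![u 2, u 3]) 1] := by
  have h1 : (lawG α β).one = 0 := rfl
  rw [LieLaw.lie_eq, h1]
  simp only [fderiv_lawG_mul, VectorField.lieBracket, fderiv_transG_mulVec, transG_zero,
    Matrix.one_mulVec]

theorem lie_lawH (α β : ℝ) (u v : Coord 3) :
    (lawH α β).lie u v =
      ![0, ((u 0 • matA α β) *ᵥ ![v 1, v 2]) 0, ((u 0 • matA α β) *ᵥ ![v 1, v 2]) 1] -
      ![0, ((v 0 • matA α β) *ᵥ ![u 1, u 2]) 0, ((v 0 • matA α β) *ᵥ ![u 1, u 2]) 1] := by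
  have h1 : (lawH α β).one = 0 := rfl
  rw [LieLaw.lie_eq, h1]
  simp only [fderiv_lawH_mul, VectorField.lieBracket, fderiv_transH_mulVec, transH_zero,
    Matrix.one_mulVec]

/-- The frame `frameG`, as coordinate vectors. -/
def frameVecG (α β m : ℝ) : Fin 4 → Coord 4 :=
  ![Pi.single 0 (zConst α β m), Pi.single 1 1, Pi.single 2 1, Pi.single 3 1]

theorem lie_frameVecG (α β m : ℝ) :
    (lawG α β).lie (frameVecG α β m 0) (frameVecG α β m 1) = 0 ∧
    (lawG α β).lie (frameVecG α β m 2) (frameVecG α β m 3) = 0 ∧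
    (lawG α β).lie (frameVecG α β m 1) (frameVecG α β m 2) =
      α • frameVecG α β m 2 + β • frameVecG α β m 3 ∧
    (lawG α β).lie (frameVecG α β m 1) (frameVecG α β m 3) =
      β • frameVecG α β m 2 + (2 - α) • frameVecG α β m 3 ∧
    (lawG α β).lie (frameVecG α β m 0) (frameVecG α β m 2) =
      matF α β m 0 0 • frameVecG α β m 2 + matF α β m 0 1 • frameVecG α β m 3 ∧
    (lawG α β).lie (frameVecG α β m 0) (frameVecG α β m 3) =
      matF α β m 1 0 • frameVecG α β m 2 + matF α β m 1 1 • frameVecG α β m 3 := by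
  simp only [lie_lawG]
  refine ⟨?_, ?_, ?_, ?_, ?_, ?_⟩ <;> funext i <;> fin_cases i <;>
    simp [frameVecG, matF, matB_apply, matA, Matrix.mulVec, dotProduct, Fin.sum_univ_two]

theorem bracket_frameG (α β m : ℝ) :
    ⁅frameG α β m 0, frameG α β m 1⁆ = 0 ∧
    ⁅frameG α β m 2, frameG α β m 3⁆ = 0 ∧
    ⁅frameG α β m 1, frameG α β m 2⁆ = α • frameG α β m 2 + β • frameG α β m 3 ∧
    ⁅frameG α β m 1, frameG α β m 3⁆ = β • frameG α β m 2 + (2 - α) • frameG α β m 3 ∧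
    ⁅frameG α β m 0, frameG α β m 2⁆ =
      matF α β m 0 0 • frameG α β m 2 + matF α β m 0 1 • frameG α β m 3 ∧
    ⁅frameG α β m 0, frameG α β m 3⁆ =
      matF α β m 1 0 • frameG α β m 2 + matF α β m 1 1 • frameG α β m 3 :=
  lie_frameVecG α β m

/-- The matrix kills `∂ₜ` and acts on the abelian fibre by a polynomial in `A`, so it commutes with
`ad ∂ₜ`. -/
theorem derivMatH_lie (α β : ℝ) (u v : Coord 3) :
    derivMatH α β *ᵥ (lawH α β).lie u v =
      (lawH α β).lie u (derivMatH α β *ᵥ v) - (lawH α β).lie v (derivMatH α β *ᵥ u) := by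
  simp only [lie_lawH]
  funext i
  fin_cases i <;>
    simp [derivMatH, matA, Matrix.mulVec, dotProduct, Fin.sum_univ_two, Fin.sum_univ_three] <;>
    ring

/-- The derivation `D = 0 ⊕ (-2 A - λ I)` of the Lie algebra of `H`. -/
def derivH (α β : ℝ) : LieDerivation ℝ (lawH α β).LieAlg (lawH α β).LieAlg where
  toLinearMap := (Matrix.toLin' (derivMatH α β) : Coord 3 →ₗ[ℝ] Coord 3)
  leibniz' u v := derivMatH_lie α β u v

/-- The fibre block is a polynomial in `A` and commutes with `exp(tA)`, so conjugation by a
translation changes nothing and the extension is constant in coordinates. -/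
theorem extend_derivH (α β : ℝ) (x : Coord 3) :
    (lawH α β).extend (derivH α β) x = derivMatH α β := by
  have e : (lawH α β).extend (derivH α β) x = jacobian ((lawH α β).mul x) (lawH α β).one *
      LinearMap.toMatrix' (Matrix.toLin' (derivMatH α β)) *
      (jacobian ((lawH α β).mul x) (lawH α β).one)⁻¹ := rfl
  have hE := expBA_mul_neg α β 0 (x 0)
  have hC := (commute_expBA_matA α β 0 (x 0)).eq
  rw [neg_zero] at hE
  have hT : transH α β x * transH α β (-x) = 1 := by
    have h' := fun i j => congrFun (congrFun hE i) j
    simp only [Matrix.mul_apply, Fin.sum_univ_two] at h'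
    ext i j
    fin_cases i <;> fin_cases j <;>
      simp [transH, Matrix.mul_apply, Fin.sum_univ_three, h']
  have hD : transH α β x * derivMatH α β = derivMatH α β * transH α β x := by
    have h' := fun i j => congrFun (congrFun hC i) j
    simp only [Matrix.mul_apply, Fin.sum_univ_two] at h'
    have h00 := h' 0 0
    have h01 := h' 0 1
    have h10 := h' 1 0
    have h11 := h' 1 1
    simp only [matA, Matrix.of_apply, Matrix.cons_val_zero, Matrix.cons_val_one,
      Matrix.cons_val', Matrix.cons_val_fin_one] at h00 h01 h10 h11
    ext i j
    fin_cases i <;> fin_cases j <;>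
      simp [transH, derivMatH, Matrix.mul_apply, Fin.sum_univ_three] <;> linarith
  rw [e, LinearMap.toMatrix'_toLin', lawH_mul, jacobian_add_mulVec, hD, Matrix.mul_assoc,
    Matrix.inv_eq_right_inv hT, hT, Matrix.mul_one]

theorem isSolvsoliton_metricH (α β : ℝ) (hβ : β ≠ 0) :
    (lawH α β).IsSolvsoliton (metricH α β) (lamConst α β) (derivH α β) where
  isSolvable := isSolvable_lawH α β
  isRiemannian := isRiemannianMetric_metricH α β hβ
  isLeftInvariant := isLeftInvariant_metricH α β
  ricci_eq x := by rw [ricciEndo_metricH α β hβ, extend_derivH]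

/-! ### Completeness -/

section Complete

variable {n : ℕ} {g : TensorField n}

theorem IsRiemannianMetric.continuous_speed (hg : IsRiemannianMetric g) {X : Type*}
    [TopologicalSpace X] {p v : X → Coord n} (hp : Continuous p) (hv : Continuous v) :
    Continuous fun t => Real.sqrt (v t ⬝ᵥ (g (p t) *ᵥ v t)) := by
  have h1 : ∀ i j, Continuous fun t => g (p t) i j := fun i j => (hg.smooth i j).continuous.comp hp
  have h2 : ∀ i, Continuous fun t => v t i := fun i => (continuous_apply i).comp hv
  refine Real.continuous_sqrt.comp ?_
  simp only [Matrix.mulVec, dotProduct]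
  exact continuous_finsetSum _ fun i _ => (h2 i).mul
    (continuous_finsetSum _ fun j _ => (h1 i j).mul (h2 j))

/-- The bound is required only along the curve, since for fibre coordinates it is available only
over a bounded region of the base. -/
theorem abs_sub_le_mul_curveLength (hg : IsRiemannianMetric g) {γ : ℝ → Coord n}
    (hγ : ContDiff ℝ 1 γ) {c : ℝ} {k : Fin n}
    (h : ∀ t ∈ Set.Icc (0 : ℝ) 1,
      |deriv γ t k| ≤ c * Real.sqrt (deriv γ t ⬝ᵥ (g (γ t) *ᵥ deriv γ t)))
    {t : ℝ} (ht : t ∈ Set.Icc (0 : ℝ) 1) : |γ t k - γ 0 k| ≤ c * curveLength g γ := by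
  have hd : Continuous (deriv γ) := hγ.continuous_deriv le_rfl
  have hs := hg.continuous_speed hγ.continuous hd
  have hk : Continuous fun s => deriv γ s k := (continuous_apply k).comp hd
  have hder : ∀ s, HasDerivAt (fun s => γ s k) (deriv γ s k) s := fun s =>
    hasDerivAt_pi.1 ((hγ.differentiable one_ne_zero s).hasDerivAt) k
  have e : ∫ s in (0 : ℝ)..t, deriv γ s k = γ t k - γ 0 k :=
    intervalIntegral.integral_eq_sub_of_hasDerivAt (fun s _ => hder s) (hk.intervalIntegrable _ _)
  calc |γ t k - γ 0 k| = |∫ s in (0 : ℝ)..t, deriv γ s k| := by rw [e]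
    _ ≤ ∫ s in (0 : ℝ)..t, |deriv γ s k| := intervalIntegral.abs_integral_le_integral_abs ht.1
    _ ≤ ∫ s in (0 : ℝ)..1, |deriv γ s k| := by
      refine intervalIntegral.integral_mono_interval le_rfl ht.1 ht.2
        (Eventually.of_forall fun s => abs_nonneg _) (hk.abs.intervalIntegrable _ _)
    _ ≤ ∫ s in (0 : ℝ)..1, c * Real.sqrt (deriv γ s ⬝ᵥ (g (γ s) *ᵥ deriv γ s)) :=
      intervalIntegral.integral_mono_on zero_le_one (hk.abs.intervalIntegrable _ _)
        ((hs.const_mul c).intervalIntegrable _ _) h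
    _ = c * curveLength g γ := by rw [intervalIntegral.integral_const_mul, curveLength]

theorem curveLength_nonneg (γ : ℝ → Coord n) : 0 ≤ curveLength g γ :=
  intervalIntegral.integral_nonneg zero_le_one fun _ _ => Real.sqrt_nonneg _

theorem riemannianDist_nonneg (x y : Coord n) : 0 ≤ riemannianDist g x y := by
  refine Real.sInf_nonneg ?_
  rintro _ ⟨γ, -, -, -, rfl⟩
  exact curveLength_nonneg γ

/-- The length of the segment from `x` to `y`. -/
def segmentLength (g : TensorField n) (x y : Coord n) : ℝ :=
  ∫ t in (0 : ℝ)..1, Real.sqrt ((y - x) ⬝ᵥ (g (x + t • (y - x)) *ᵥ (y - x)))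

theorem segment_mem (g : TensorField n) (x y : Coord n) :
    ∃ γ : ℝ → Coord n, ContDiff ℝ 1 γ ∧ γ 0 = x ∧ γ 1 = y ∧
      segmentLength g x y = curveLength g γ := by
  have hd : deriv (fun t : ℝ => x + t • (y - x)) = fun _ => y - x := by
    funext t
    have := ((hasDerivAt_id t).smul_const (y - x)).const_add x
    simpa using this.deriv
  refine ⟨fun t => x + t • (y - x), by fun_prop, by simp, by simp, ?_⟩
  simp only [segmentLength, curveLength, hd]

theorem riemannianDist_le_segmentLength (x y : Coord n) :
    riemannianDist g x y ≤ segmentLength g x y := by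
  refine csInf_le ⟨0, ?_⟩ (segment_mem g x y)
  rintro _ ⟨γ, -, -, -, rfl⟩
  exact curveLength_nonneg γ

theorem exists_curve_of_riemannianDist_lt {x y : Coord n} {r : ℝ} (h : riemannianDist g x y < r) :
    ∃ γ : ℝ → Coord n, ContDiff ℝ 1 γ ∧ γ 0 = x ∧ γ 1 = y ∧ curveLength g γ < r := by
  obtain ⟨_, ⟨γ, h1, h2, h3, rfl⟩, h4⟩ := exists_lt_of_csInf_lt (s := {L | ∃ γ : ℝ → Coord n,
    ContDiff ℝ 1 γ ∧ γ 0 = x ∧ γ 1 = y ∧ L = curveLength g γ}) ⟨_, segment_mem g x y⟩ h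
  exact ⟨γ, h1, h2, h3, h4⟩

/-- The distance is at most the length of the straight segment, which is continuous in the endpoint
and vanishes at `a`. -/
theorem tendsto_riemannianDist (hg : IsRiemannianMetric g) {u : ℕ → Coord n} {a : Coord n}
    (h : Tendsto u atTop (𝓝 a)) : Tendsto (fun i => riemannianDist g (u i) a) atTop (𝓝 0) := by
  have hc : Continuous fun x => segmentLength g x a := by
    refine intervalIntegral.continuous_parametric_intervalIntegral_of_continuous' ?_ 0 1
    exact hg.continuous_speed (X := Coord n × ℝ) (p := fun q => q.1 + q.2 • (a - q.1))
      (v := fun q => a - q.1) (by fun_prop) (by fun_prop)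
  have h0 : segmentLength g a a = 0 := by simp [segmentLength]
  have h1 := (hc.tendsto a).comp h
  rw [h0] at h1
  exact squeeze_zero (fun i => riemannianDist_nonneg _ _)
    (fun i => riemannianDist_le_segmentLength _ _) h1

/-- A metric is complete if it bounds some of the coordinates of tangent vectors uniformly, and
bounds all coordinates over each region in which the coordinates of the first kind are bounded. -/
theorem isCompleteMetric_of_bounds (hg : IsRiemannianMetric g) (S : Set (Fin n)) {c : ℝ}
    (hc : 0 ≤ c) (hS : ∀ x v, ∀ k ∈ S, |v k| ≤ c * Real.sqrt (v ⬝ᵥ (g x *ᵥ v)))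
    (h : ∀ K, ∃ C, 0 ≤ C ∧ ∀ x, (∀ k ∈ S, |x k| ≤ K) →
      ∀ v k, |v k| ≤ C * Real.sqrt (v ⬝ᵥ (g x *ᵥ v))) : IsCompleteMetric g := by
  intro u hu
  obtain ⟨N, hN⟩ := hu 1 one_pos
  have hbase : ∀ {x y : Coord n} {r : ℝ} (γ : ℝ → Coord n), ContDiff ℝ 1 γ → γ 0 = x →
      curveLength g γ < r → ∀ t ∈ Set.Icc (0 : ℝ) 1, ∀ k ∈ S, |γ t k - x k| ≤ c * r := by
    rintro x y r γ h1 rfl h4 t ht k hk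
    exact (abs_sub_le_mul_curveLength hg h1 (fun s _ => hS _ _ k hk) ht).trans (by gcongr)
  -- A curve of length less than 1 from `u N` to `u i`, followed by one of length less than 1 from
  -- `u i`, moves each controlled coordinate by at most `c` twice.
  obtain ⟨C, hC, hb⟩ := h (‖u N‖ + c + c)
  have key : ∀ i ≥ N, ∀ j ≥ N, ∀ r ≤ 1, riemannianDist g (u i) (u j) < r →
      ∀ k, |u j k - u i k| ≤ C * r := by
    intro i hi j hj r hr hd k
    obtain ⟨γ₀, h1, h2, h3, h4⟩ := exists_curve_of_riemannianDist_lt (hN N le_rfl i hi)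
    obtain ⟨γ, h5, h6, h7, h8⟩ := exists_curve_of_riemannianDist_lt hd
    have e : ∀ t ∈ Set.Icc (0 : ℝ) 1, ∀ k ∈ S, |γ t k| ≤ ‖u N‖ + c + c := by
      intro t ht k hk
      have b1 := hbase (y := u i) γ₀ h1 h2 h4 1 (by simp) k hk
      rw [h3] at b1
      have b2 := hbase (y := u j) γ h5 h6 (h8.trans_le hr) t ht k hk
      have b3 := norm_le_pi_norm (u N) k
      rw [Real.norm_eq_abs] at b3
      rw [abs_le] at *
      constructor <;> linarith [b1.1, b1.2, b2.1, b2.2, b3.1, b3.2]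
    have := abs_sub_le_mul_curveLength hg h5 (fun t ht => hb _ (e t ht) _ k)
      (t := 1) (by simp)
    rw [h6, h7] at this
    exact this.trans (by gcongr)
  have hcauchy : CauchySeq u := by
    rw [Metric.cauchySeq_iff]
    intro ε hε
    -- `C` may be zero, so the division is by `C + 1`.
    have hC1 : 0 < C + 1 := by linarith
    obtain ⟨M, hM⟩ := hu (min 1 (ε / (C + 1))) (by positivity)
    refine ⟨max N M, fun i hi j hj => ?_⟩
    have hi' := max_le_iff.1 hi
    have hj' := max_le_iff.1 hj
    rw [dist_comm, dist_pi_lt_iff hε]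
    intro k
    rw [Real.dist_eq]
    refine (key i hi'.1 j hj'.1 _ (min_le_left _ _) (hM i hi'.2 j hj'.2) k).trans_lt ?_
    calc C * min 1 (ε / (C + 1)) ≤ C * (ε / (C + 1)) := by gcongr; exact min_le_right _ _
      _ < (C + 1) * (ε / (C + 1)) := by gcongr; linarith
      _ = ε := by field_simp
  obtain ⟨a, ha⟩ := cauchySeq_tendsto_of_complete hcauchy
  exact ⟨a, tendsto_riemannianDist hg ha⟩

end Complete

theorem metricG_quadratic (α β m : ℝ) (x v : Coord 4) :
    v ⬝ᵥ (metricG α β m x *ᵥ v) = (v 0 / zConst α β m) ^ 2 + v 1 ^ 2 +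
      (expBA α β (-x 0) (-x 1) *ᵥ ![v 2, v 3]) 0 ^ 2 +
      (expBA α β (-x 0) (-x 1) *ᵥ ![v 2, v 3]) 1 ^ 2 := by
  simp [metricG, Matrix.mulVec, dotProduct, Fin.sum_univ_four, Fin.sum_univ_two, Matrix.mul_apply]
  ring

/-- The controlled coordinates are `s` and `t`, with constants `z` and `1`, both below `z + 1`. A
fibre vector is recovered from its frame components by `exp(sB + tA)`, whose entries are bounded on
the compact square `|s|, |t| ≤ K`. -/
theorem isCompleteMetric_metricG (α β m : ℝ) (hβ : β ≠ 0) (hm : 0 < m) :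
    IsCompleteMetric (metricG α β m) := by
  have hz := zConst_pos α β m hβ hm
  have hbase : ∀ x v : Coord 4, ∀ k ∈ ({0, 1} : Set (Fin 4)),
      |v k| ≤ (zConst α β m + 1) * Real.sqrt (v ⬝ᵥ (metricG α β m x *ᵥ v)) := by
    intro x v k hk
    rw [metricG_quadratic]
    set w := expBA α β (-x 0) (-x 1) *ᵥ ![v 2, v 3]
    have hs := Real.sqrt_nonneg ((v 0 / zConst α β m) ^ 2 + v 1 ^ 2 + w 0 ^ 2 + w 1 ^ 2)
    rcases hk with rfl | rfl
    · have h1 : |v 0 / zConst α β m| ≤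
          Real.sqrt ((v 0 / zConst α β m) ^ 2 + v 1 ^ 2 + w 0 ^ 2 + w 1 ^ 2) :=
        Real.abs_le_sqrt (by nlinarith [sq_nonneg (v 1), sq_nonneg (w 0), sq_nonneg (w 1)])
      rw [abs_div, abs_of_pos hz, div_le_iff₀ hz] at h1
      linarith
    · have h1 : |v 1| ≤ Real.sqrt ((v 0 / zConst α β m) ^ 2 + v 1 ^ 2 + w 0 ^ 2 + w 1 ^ 2) :=
        Real.abs_le_sqrt
          (by nlinarith [sq_nonneg (v 0 / zConst α β m), sq_nonneg (w 0), sq_nonneg (w 1)])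
      nlinarith
  refine isCompleteMetric_of_bounds (isRiemannianMetric_metricG α β m hβ hm) {0, 1}
    (by positivity) hbase fun K => ?_
  have hbd : ∀ i j, ∃ C, ∀ p ∈ Set.Icc (-K) K ×ˢ Set.Icc (-K) K,
      ‖expBA α β p.1 p.2 i j‖ ≤ C := fun i j =>
    (isCompact_Icc.prod isCompact_Icc).exists_bound_of_continuousOn
      (contDiff_expBA α β i j).continuous.continuousOn
  choose C hC using hbd
  refine ⟨zConst α β m + 1 + ∑ i, ∑ j, |C i j|, by positivity, fun x hx v => ?_⟩
  have hx0 := abs_le.1 (hx 0 (by simp))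
  have hx1 := abs_le.1 (hx 1 (by simp))
  have hE : ∀ i j, |expBA α β (x 0) (x 1) i j| ≤ |C i j| := fun i j =>
    (hC i j (x 0, x 1) ⟨hx0, hx1⟩).trans (le_abs_self _)
  have hb0 := hbase x v 0 (by simp)
  have hb1 := hbase x v 1 (by simp)
  rw [metricG_quadratic] at *
  set w := expBA α β (-x 0) (-x 1) *ᵥ ![v 2, v 3] with hw
  set s := Real.sqrt ((v 0 / zConst α β m) ^ 2 + v 1 ^ 2 + w 0 ^ 2 + w 1 ^ 2)
  have hs : 0 ≤ s := Real.sqrt_nonneg _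
  have w0 : |w 0| ≤ s := Real.abs_le_sqrt
    (by nlinarith [sq_nonneg (v 0 / zConst α β m), sq_nonneg (v 1), sq_nonneg (w 1)])
  have w1 : |w 1| ≤ s := Real.abs_le_sqrt
    (by nlinarith [sq_nonneg (v 0 / zConst α β m), sq_nonneg (v 1), sq_nonneg (w 0)])
  have hv : ∀ i, ![v 2, v 3] i =
      expBA α β (x 0) (x 1) i 0 * w 0 + expBA α β (x 0) (x 1) i 1 * w 1 := by
    intro i
    have h : expBA α β (x 0) (x 1) *ᵥ w = ![v 2, v 3] := by
      rw [hw, Matrix.mulVec_mulVec, expBA_mul_neg, Matrix.one_mulVec]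
    rw [← h]
    simp [Matrix.mulVec, dotProduct, Fin.sum_univ_two]
  have hfib : ∀ i, |![v 2, v 3] i| ≤ (|C i 0| + |C i 1|) * s := by
    intro i
    rw [hv]
    calc _ ≤ |expBA α β (x 0) (x 1) i 0| * |w 0| + |expBA α β (x 0) (x 1) i 1| * |w 1| := by
          rw [← abs_mul, ← abs_mul]
          exact abs_add_le _ _
      _ ≤ |C i 0| * s + |C i 1| * s := by
          exact add_le_add (mul_le_mul (hE i 0) w0 (abs_nonneg _) (abs_nonneg _))
            (mul_le_mul (hE i 1) w1 (abs_nonneg _) (abs_nonneg _))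
      _ = _ := by ring
  have n00 := abs_nonneg (C 0 0)
  have n01 := abs_nonneg (C 0 1)
  have n10 := abs_nonneg (C 1 0)
  have n11 := abs_nonneg (C 1 1)
  have hsum : ∑ i, ∑ j, |C i j| = |C 0 0| + |C 0 1| + (|C 1 0| + |C 1 1|) := by
    simp [Fin.sum_univ_two]
  rw [hsum]
  have mono : ∀ {a b : ℝ} (y : ℝ), |y| ≤ a * s → a ≤ b → |y| ≤ b * s := fun y h1 h2 =>
    h1.trans (mul_le_mul_of_nonneg_right h2 hs)
  intro k
  fin_cases k
  · exact mono _ hb0 (by linarith)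
  · exact mono _ hb1 (by linarith)
  · exact mono _ (hfib 0) (by linarith)
  · exact mono _ (hfib 1) (by linarith)

theorem isWarpedEinstein_metricG (α β m : ℝ) (hβ : β ≠ 0) (hm : 0 < m) :
    IsWarpedEinstein (lamConst α β) m (metricG α β m) (potentialG α β m) where
  isRiemannian := isRiemannianMetric_metricG α β m hβ hm
  isComplete := isCompleteMetric_metricG α β m hβ hm
  smooth := contDiff_potentialG α β m
  pos _ := Real.exp_pos _
  hess_eq := hess_eq_ricci_sub α β m hβ hm
  laplacian_eq := by
    rintro rfl x
    exact laplacian_potentialG α β hβ x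

/-! ### Smooth convergence -/

section Convergence

variable {E F ι : Type*} [NormedAddCommGroup E] [NormedSpace ℝ E] [NormedAddCommGroup F]
  [NormedSpace ℝ F]

/-- Composition of a smooth function with convergent linear maps converges in `C^∞`. -/
theorem tendstoUniformlyOn_iteratedFDeriv_comp_clm {f : E → F} (hf : ContDiff ℝ ∞ f)
    {l : Filter ι} {Λ : ι → E →L[ℝ] E} {Λ₀ : E →L[ℝ] E} (hΛ : Tendsto Λ l (𝓝 Λ₀)) (k : ℕ)
    {K : Set E} (hK : IsCompact K) :
    TendstoUniformlyOn (fun m x => iteratedFDeriv ℝ k (fun y => f (Λ m y)) x)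
      (fun x => iteratedFDeriv ℝ k (fun y => f (Λ₀ y)) x) l K := by
  have hk : (k : WithTop ℕ∞) ≤ ∞ := by exact_mod_cast le_top
  have e : ∀ (A : E →L[ℝ] E) x, iteratedFDeriv ℝ k (fun y => f (A y)) x =
      (iteratedFDeriv ℝ k f (A x)).compContinuousLinearMap fun _ => A := fun A x =>
    A.iteratedFDeriv_comp_right hf x hk
  -- Joint continuity in the linear map and the point: after currying, convergence of the linear
  -- maps gives convergence in the compact-open topology, that is, uniformly on compact sets.
  have hc : Continuous fun p : (E →L[ℝ] E) × E =>
      (iteratedFDeriv ℝ k f (p.1 p.2)).compContinuousLinearMap fun _ : Fin k => p.1 := by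
    have h1 : Continuous fun p : (E →L[ℝ] E) × E =>
        ContinuousMultilinearMap.compContinuousLinearMapContinuousMultilinear ℝ
          (fun _ : Fin k => E) (fun _ : Fin k => E) F fun _ => p.1 :=
      (ContinuousMultilinearMap.cont _).comp (continuous_pi fun _ => continuous_fst)
    have h2 : Continuous fun p : (E →L[ℝ] E) × E => iteratedFDeriv ℝ k f (p.1 p.2) :=
      (hf.continuous_iteratedFDeriv hk).comp (continuous_fst.clm_apply continuous_snd)
    exact h1.clm_apply h2
  let G := ContinuousMap.curry ⟨_, hc⟩
  have h := (G.continuous.tendsto Λ₀).comp hΛ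
  simp only [e]
  exact ContinuousMap.tendsto_iff_forall_isCompact_tendstoUniformlyOn.1 h K hK

theorem tendstoUniformlyOn_iteratedFDeriv_const {l : Filter ι} {c : ι → F} {c₀ : F}
    (hc : Tendsto c l (𝓝 c₀)) (k : ℕ) (K : Set E) :
    TendstoUniformlyOn (fun m x => iteratedFDeriv ℝ k (fun _ : E => c m) x)
      (fun x => iteratedFDeriv ℝ k (fun _ : E => c₀) x) l K := by
  rcases Nat.eq_zero_or_pos k with rfl | hk
  · have h := ((continuousMultilinearCurryFin0 ℝ E F).symm.continuous.tendsto c₀).comp hc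
    simp only [iteratedFDeriv_zero_eq_comp]
    exact h.tendstoUniformlyOn_const K
  · simp only [iteratedFDeriv_const_of_ne hk.ne']
    exact tendsto_const_nhds.tendstoUniformlyOn_const K

end Convergence

theorem SmoothTendsto.congr' {n : ℕ} {T S : ℝ → TensorField n} {T' : TensorField n}
    (h : SmoothTendsto T T') (e : ∀ᶠ m in atTop, T m = S m) : SmoothTendsto S T' := by
  intro i j k K hK
  refine (h i j k K hK).congr ?_
  filter_upwards [e] with m hm
  rw [hm]
  exact fun _ _ => rfl

theorem smoothTendsto_comp_clm {n : ℕ} {T : TensorField n}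
    (hT : ∀ i j, ContDiff ℝ ∞ fun x => T x i j) {Λ : ℝ → Coord n →L[ℝ] Coord n}
    {Λ₀ : Coord n →L[ℝ] Coord n} (hΛ : Tendsto Λ atTop (𝓝 Λ₀)) :
    SmoothTendsto (fun m x => T (Λ m x)) (fun x => T (Λ₀ x)) := fun i j k _ hK =>
  tendstoUniformlyOn_iteratedFDeriv_comp_clm (hT i j) hΛ k hK

theorem smoothTendsto_const {n : ℕ} {M : ℝ → Matrix (Fin n) (Fin n) ℝ}
    {M₀ : Matrix (Fin n) (Fin n) ℝ} (hM : ∀ i j, Tendsto (fun m => M m i j) atTop (𝓝 (M₀ i j))) :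
    SmoothTendsto (fun m _ => M m) (fun _ => M₀) := fun i j k K _ =>
  tendstoUniformlyOn_iteratedFDeriv_const (hM i j) k K

/-! ### The rescaling `(x, h) ↦ (zx, h)` and the limits as `m → ∞`. -/

theorem tendsto_zConst (α β : ℝ) (hβ : β ≠ 0) : Tendsto (zConst α β) atTop (𝓝 0) := by
  have hl := lamConst_add_two_neg α β hβ
  have h1 : Tendsto (fun m : ℝ => -(lamConst α β * (m + 2) + 4)) atTop atTop := by
    have e : (fun m : ℝ => -(lamConst α β * (m + 2) + 4)) =
        fun m => (-lamConst α β) * m + (-2 * lamConst α β - 4) := by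
      funext m
      ring
    rw [e]
    exact tendsto_atTop_add_const_right _ _ (tendsto_id.const_mul_atTop (by linarith))
  exact (Real.tendsto_sqrt_atTop.comp h1).const_div_atTop 2

/-- Multiplication of the coordinate `0` by `z`. -/
def scaleCLM (z : ℝ) : Coord 4 →L[ℝ] Coord 4 :=
  ContinuousLinearMap.id ℝ (Coord 4) + (z - 1) •
    (ContinuousLinearMap.proj (R := ℝ) (φ := fun _ : Fin 4 => ℝ) 0).smulRight (Pi.single 0 1)

theorem scaleCLM_apply (z : ℝ) (x : Coord 4) : scaleCLM z x = ![z * x 0, x 1, x 2, x 3] := by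
  funext i
  fin_cases i <;> simp [scaleCLM]
  ring

theorem tendsto_scaleCLM {z : ℝ → ℝ} (hz : Tendsto z atTop (𝓝 0)) :
    Tendsto (fun m => scaleCLM (z m)) atTop (𝓝 (scaleCLM 0)) :=
  ((hz.sub_const 1).smul_const _).const_add _

/-- Multiplication of the coordinate `0` by `z ≠ 0`. -/
def scaleEquiv (z : ℝ) (hz : z ≠ 0) : Coord 4 ≃L[ℝ] Coord 4 :=
  ContinuousLinearEquiv.equivOfInverse (scaleCLM z) (scaleCLM z⁻¹)
    (fun x => by
      funext i
      fin_cases i <;> simp [scaleCLM_apply, hz])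
    (fun x => by
      funext i
      fin_cases i <;> simp [scaleCLM_apply, hz])

theorem jacobian_scaleCLM (z : ℝ) (x : Coord 4) :
    jacobian (scaleCLM z) x = Matrix.diagonal ![z, 1, 1, 1] := by
  have e : (scaleCLM z : Coord 4 → Coord 4) =
      fun y => 0 + Matrix.diagonal ![z, 1, 1, 1] *ᵥ y := by
    funext y i
    rw [scaleCLM_apply, zero_add, Matrix.mulVec_diagonal]
    fin_cases i <;> simp
  rw [e, jacobian_add_mulVec]

/-- The diffeomorphisms `(x, h) ↦ (z x, h)` from `ℝ × H` to `G`; the parameters with `z = 0`,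
which do not occur for `m > 0`, get the identity. -/
def productDiffeo (α β m : ℝ) :
    Diffeomorph 𝓘(ℝ, Coord 4) 𝓘(ℝ, Coord 4) (Coord 4) (Coord 4) ∞ :=
  open Classical in
  (if h : zConst α β m = 0 then ContinuousLinearEquiv.refl ℝ (Coord 4)
    else scaleEquiv (zConst α β m) h).toDiffeomorph

theorem productDiffeo_zero (α β m : ℝ) : productDiffeo α β m 0 = 0 := by
  unfold productDiffeo
  rw [ContinuousLinearEquiv.coe_toDiffeomorph, map_zero]

theorem coe_productDiffeo (α β m : ℝ) (h : zConst α β m ≠ 0) :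
    (productDiffeo α β m : Coord 4 → Coord 4) = scaleCLM (zConst α β m) := by
  unfold productDiffeo
  rw [dif_neg h]
  rfl

/-- The metric `dx² + dt² + |exp (-(s B + t A)) dy|²`. -/
def scaledMetric (α β : ℝ) : TensorField 4 := fun x =>
  !![1, 0, 0, 0; 0, 1, 0, 0;
    0, 0, gramOneG α β x + gramAG α β x * α, gramAG α β x * β;
    0, 0, gramAG α β x * β, gramOneG α β x + gramAG α β x * (2 - α)]

theorem contDiff_scaledMetric (α β : ℝ) (i j : Fin 4) :
    ContDiff ℝ ∞ fun x => scaledMetric α β x i j := by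
  have h1 := contDiff_gramOneG α β
  have h2 := contDiff_gramAG α β
  fin_cases i <;> fin_cases j <;> simp [scaledMetric] <;> fun_prop

/-- The Jacobian factor `z²` cancels the `z⁻²` of the metric, so `m` survives only in the linear
change of variables. -/
theorem pullback_productDiffeo (α β m : ℝ) (hβ : β ≠ 0) (hm : 0 < m) :
    pullback (productDiffeo α β m) (metricG α β m) =
      fun x => scaledMetric α β (scaleCLM (zConst α β m) x) := by
  have hz := (zConst_pos α β m hβ hm).ne'
  funext x
  unfold pullback
  rw [coe_productDiffeo α β m hz, jacobian_scaleCLM, metricG_eq α β m hβ]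
  ext i j
  rw [Matrix.diagonal_transpose, Matrix.mul_diagonal, Matrix.diagonal_mul]
  fin_cases i <;> fin_cases j <;> simp [scaledMetric]
  field_simp

/-- At `z = 0` the linear map is the projection that kills `s`, turning `exp(-(sB + tA))` into
`exp(-tA)`. The limit map need not be invertible for `smoothTendsto_comp_clm`. -/
theorem lineProd_metricH (α β : ℝ) (hβ : β ≠ 0) :
    lineProd (metricH α β) = fun x => scaledMetric α β (scaleCLM 0 x) := by
  funext x
  have h1 : gramOneG α β (scaleCLM 0 x) = gramOneH α β (Fin.tail x) := by
    simp [gramOneG, gramOneH, scaleCLM_apply, Fin.tail]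
  have h2 : gramAG α β (scaleCLM 0 x) = gramAH α β (Fin.tail x) := by
    simp [gramAG, gramAH, scaleCLM_apply, Fin.tail]
  ext i j
  simp only [lineProd, scaledMetric, h1, h2, metricH_eq α β hβ]
  fin_cases i <;> fin_cases j <;> rfl

theorem smoothTendsto_pullback_metricG (α β : ℝ) (hβ : β ≠ 0) :
    SmoothTendsto (fun m => pullback (productDiffeo α β m) (metricG α β m))
      (lineProd (metricH α β)) := by
  rw [lineProd_metricH α β hβ]
  refine (smoothTendsto_comp_clm (contDiff_scaledMetric α β)
    (tendsto_scaleCLM (tendsto_zConst α β hβ))).congr' ?_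
  filter_upwards [eventually_gt_atTop 0] with m hm
  exact (pullback_productDiffeo α β m hβ hm).symm

/-- `hessMatG` is block diagonal with respect to the coordinate 0, so it commutes with the Jacobian
`diag(z, 1, 1, 1)`. -/
theorem pullbackEndo_productDiffeo (α β m : ℝ) (hβ : β ≠ 0) (hm : 0 < m) :
    (pullbackEndo (productDiffeo α β m) fun x =>
      (m / potentialG α β m x) • hessianEndo (metricG α β m) (potentialG α β m) x) =
    fun _ => hessMatG α β m := by
  have hz := (zConst_pos α β m hβ hm).ne'
  have hw : ∀ x, potentialG α β m x ≠ 0 := fun x => (Real.exp_pos _).ne'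
  funext x
  unfold pullbackEndo
  beta_reduce
  rw [coe_productDiffeo α β m hz, jacobian_scaleCLM, hessianEndo_potentialG α β m hβ hm, smul_smul,
    div_mul_div_cancel₀ (hw _), div_self hm.ne', one_smul, Matrix.mul_assoc]
  have hdet : IsUnit (Matrix.diagonal ![zConst α β m, 1, 1, 1]).det := by
    simp [Matrix.det_diagonal, Fin.prod_univ_four, hz]
  have hc : hessMatG α β m * Matrix.diagonal ![zConst α β m, 1, 1, 1] =
      Matrix.diagonal ![zConst α β m, 1, 1, 1] * hessMatG α β m := by
    ext i j
    rw [Matrix.mul_diagonal, Matrix.diagonal_mul]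
    fin_cases i <;> fin_cases j <;> simp [hessMatG]
    ring
  rw [hc, ← Matrix.mul_assoc, Matrix.nonsing_inv_mul _ hdet, Matrix.one_mul]

/-- On the fibre `D = -2A - λ = -2B`, the form comparable with `hessMatG`. -/
theorem lineSum_derivMatH (α β : ℝ) :
    lineSum (-lamConst α β) ((lawH α β).extend (derivH α β)) = fun _ =>
      !![-lamConst α β, 0, 0, 0; 0, 0, 0, 0;
        0, 0, -2 * matB α β 0 0, -2 * matB α β 0 1;
        0, 0, -2 * matB α β 1 0, -2 * matB α β 1 1] := by
  have e : derivMatH α β = !![0, 0, 0; 0, -2 * matB α β 0 0, -2 * matB α β 0 1;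
      0, -2 * matB α β 1 0, -2 * matB α β 1 1] := by
    simp only [derivMatH, matB_apply]
    congr 4 <;> ring_nf
  funext x
  ext i j
  simp only [lineSum, extend_derivH, e]
  fin_cases i <;> fin_cases j <;> rfl

theorem smoothTendsto_hessianEndo (α β : ℝ) (hβ : β ≠ 0) :
    SmoothTendsto
      (fun m => pullbackEndo (productDiffeo α β m) fun x =>
        (m / potentialG α β m x) • hessianEndo (metricG α β m) (potentialG α β m) x)
      (lineSum (-lamConst α β) ((lawH α β).extend (derivH α β))) := by
  have hz2 : Tendsto (fun m => zConst α β m ^ 2) atTop (𝓝 0) := by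
    simpa using (tendsto_zConst α β hβ).pow 2
  have h1 : Tendsto (fun m => rhoConst α β m - lamConst α β) atTop (𝓝 (-lamConst α β)) := by
    have h := (hz2.neg.mul_const (lamConst α β * (lamConst α β + 2) / 2)).sub_const (lamConst α β)
    rw [neg_zero, zero_mul, zero_sub] at h
    refine h.congr' ?_
    filter_upwards [eventually_gt_atTop 0] with m hm
    rw [rhoConst_eq α β m hβ hm]
  -- By `zConst_sq` this coefficient equals `-(z²(2 + λ) + 2)`, and `z² → 0`.
  have h2 : Tendsto (fun m => lamConst α β * m * zConst α β m ^ 2 / 2) atTop (𝓝 (-2)) := by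
    have h := ((hz2.mul_const (2 + lamConst α β)).add_const 2).neg
    rw [zero_mul, zero_add] at h
    refine h.congr' ?_
    filter_upwards [eventually_gt_atTop 0] with m hm
    linear_combination (-1 / 2) * zConst_sq α β m hβ hm
  rw [lineSum_derivMatH]
  have h3 : SmoothTendsto (fun m _ => hessMatG α β m) fun _ =>
      !![-lamConst α β, 0, 0, 0; 0, 0, 0, 0;
        0, 0, -2 * matB α β 0 0, -2 * matB α β 0 1;
        0, 0, -2 * matB α β 1 0, -2 * matB α β 1 1] := by
    refine smoothTendsto_const fun i j => ?_
    fin_cases i <;> fin_cases j <;>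
      first
        | exact tendsto_const_nhds
        | exact h1
        | exact h2.mul_const _
  refine h3.congr' ?_
  filter_upwards [eventually_gt_atTop 0] with m hm
  exact (pullbackEndo_productDiffeo α β m hβ hm).symm

end

theorem mainTheorem7 (α β : ℝ) (hβ : β ≠ 0) (hαβ : (α - 1) ^ 2 + β ^ 2 ≠ 1) :
    (Group.IsSolvable (lawG α β).Carrier ∧
      ∀ m : ℝ, 0 < m →
        IsWarpedEinstein (lamConst α β) m (metricG α β m) (potentialG α β m) ∧
        (lawG α β).IsLeftInvariant (metricG α β m) ∧
        (∀ i j, (lawG α β).innerAtOne (metricG α β m) (frameG α β m i) (frameG α β m j) =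
          if i = j then 1 else 0) ∧
        ⁅frameG α β m 0, frameG α β m 1⁆ = 0 ∧
        ⁅frameG α β m 2, frameG α β m 3⁆ = 0 ∧
        ⁅frameG α β m 1, frameG α β m 2⁆ = α • frameG α β m 2 + β • frameG α β m 3 ∧
        ⁅frameG α β m 1, frameG α β m 3⁆ = β • frameG α β m 2 + (2 - α) • frameG α β m 3 ∧
        ⁅frameG α β m 0, frameG α β m 2⁆ =
          matF α β m 0 0 • frameG α β m 2 + matF α β m 0 1 • frameG α β m 3 ∧
        ⁅frameG α β m 0, frameG α β m 3⁆ =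
          matF α β m 1 0 • frameG α β m 2 + matF α β m 1 1 • frameG α β m 3) ∧
    ∃ D : LieDerivation ℝ (lawH α β).LieAlg (lawH α β).LieAlg,
      (lawH α β).IsSolvsoliton (metricH α β) (lamConst α β) D ∧
      ¬ IsEinstein (metricH α β) ∧
      ∃ φ : ℝ → Diffeomorph 𝓘(ℝ, Coord 4) 𝓘(ℝ, Coord 4) (Coord 4) (Coord 4) ∞,
        (∀ m, φ m 0 = (lawG α β).one) ∧
        SmoothTendsto (fun m => pullback (φ m) (metricG α β m)) (lineProd (metricH α β)) ∧
        SmoothTendsto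
          (fun m => pullbackEndo (φ m) fun x =>
            (m / potentialG α β m x) • hessianEndo (metricG α β m) (potentialG α β m) x)
          (lineSum (-lamConst α β) ((lawH α β).extend D)) :=
  ⟨⟨isSolvable_lawG α β, fun m hm => ⟨isWarpedEinstein_metricG α β m hβ hm,
      isLeftInvariant_metricG α β m, innerAtOne_frameG α β m hβ hm, bracket_frameG α β m⟩⟩,
    derivH α β, isSolvsoliton_metricH α β hβ, not_isEinstein_metricH α β hβ,
    productDiffeo α β, productDiffeo_zero α β, smoothTendsto_pullback_metricG α β hβ,
    smoothTendsto_hessianEndo α β hβ⟩
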